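/- Let $d\ge 3$, $T>0$, $D>0$, $\delta>0$. Let $\omega\in L^1(\mathbb{R}^d)\cap W^{4,\infty}(\mathbb{R}^d)$ be nonnegative with $$\int_{\mathbb{R}^d}\omega(y)\,dy=1,\qquad \int_{\mathbb{R}^d}y\,\omega(y)\,dy=0,\qquad \int_{\mathbb{R}^d}|y|^2\omega(y)\,dy<\infty .$$ For a density $u\in L^1(\mathbb{R}^d)\cap L^\infty(\mathbb{R}^d)$ put $\Phi(u)=-\delta\,\Delta(\omega\star\omega\star u)$, where $\star$ is convolution in $x$, and consider the nonlocal Cahn–Hilliard equation $$\partial_t\varrho-D\Delta\varrho-\operatorname{div}\big(\varrho\nabla\Phi(\varrho)\big)=0\quad\text{on }(0,T)\times\mathbb{R}^d .$$ Given $\varrho^0\in L^1(\mathbb{R}^d)$, a function $\varrho$ in the class $$L^\infty((0,T)\times\mathbb{R}^d)\cap L^\infty(0,T;L^1(\mathbb{R}^d))\cap C^w([0,T);L^1(\mathbb{R}^d))$$ (the last space consisting of the functions $t\mapsto\varrho(t)\in L^1(\mathbb{R}^d)$ that are continuous for the weak topology of $L^1(\mathbb{R}^d)$) is a distributional solution with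 initial datum $\varrho^0$ if, for every $\varphi\in C_c^\infty([0,T)\times\mathbb{R}^d)$, $$-\int_{\mathbb{R}^d}\varrho^0\varphi(0,x)\,dx-\int_0^T\!\!\int_{\mathbb{R}^d}\varrho\,\partial_t\varphi\,dx\,dt = D\int_0^T\!\!\int_{\mathbb{R}^d}\varrho\,\Delta\varphi\,dx\,dt-\int_0^T\!\!\int_{\mathbb{R}^d}\varrho\,\nabla\Phi(\varrho)\cdot\nabla\varphi\,dx\,dt .$$ Then distributional solutions in this class are unique: if $\varrho_1,\varrho_2$ are two distributional solutions in this class with the same initial datum $\varrho^0$, then $\varrho_1(t)=\varrho_2(t)$ almost everywhere in $\mathbb{R}^d$ for every $t\in[0,T)$. -/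

import Mathlib

open MeasureTheory Set Filter Topology
open scoped ENNReal NNReal Convolution

noncomputable section

namespace NonlocalCahnHilliard

/-- The space `ℝ^d` with its Euclidean structure. -/
abbrev Space (d : ℕ) : Type := EuclideanSpace ℝ (Fin d)

/-- `g` is the weak partial derivative of `f` in the `i`-th coordinate direction on `ℝ^d`. -/
def HasWeakPartialDeriv {d : ℕ} (i : Fin d) (f g : Space d → ℝ) : Prop :=
  LocallyIntegrable f ∧ LocallyIntegrable g ∧
    ∀ η : Space d → ℝ, ContDiff ℝ (⊤ : ℕ∞) η → HasCompactSupport η →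
      ∫ x, f x * fderiv ℝ η x (EuclideanSpace.single i 1) = -∫ x, g x * η x

/-- Membership in the Sobolev space `W^{k,∞}(ℝ^d)`: `f` is essentially bounded and so are all its
weak derivatives up to order `k`. -/
def MemSobolevInfty {d : ℕ} : ℕ → (Space d → ℝ) → Prop
  | 0, f => MemLp f ∞ volume
  | k + 1, f => MemLp f ∞ volume ∧
      ∀ i : Fin d, ∃ g : Space d → ℝ, HasWeakPartialDeriv i f g ∧ MemSobolevInfty k g

/-- The assumptions on the short-range kernel `ω`: it is nonnegative, of class `W^{4,∞}`, of mass
one, centered, and has a finite second moment. -/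
structure IsShortRangeKernel {d : ℕ} (ω : Space d → ℝ) : Prop where
  nonneg : ∀ᵐ y, 0 ≤ ω y
  integrable : Integrable ω
  integral_eq_one : ∫ y, ω y = 1
  centered : ∫ y, ω y • y = 0
  second_moment : Integrable (fun y => ‖y‖ ^ 2 * ω y)
  regular : MemSobolevInfty 4 ω

/-- The potential `Φ(u) = -δ Δ[ω ⋆ ω ⋆ u]` generated by a density `u` on `ℝ^d`. -/
def potential {d : ℕ} (δ : ℝ) (ω u : Space d → ℝ) : Space d → ℝ := fun x =>
  -δ * Laplacian.laplacian
    (ω ⋆[ContinuousLinearMap.mul ℝ ℝ, volume] (ω ⋆[ContinuousLinearMap.mul ℝ ℝ, volume] u)) x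

/-- The class `L^∞_{t,x} ∩ L^∞_t L^1_x ∩ C^w_t L^1_x` on `[0, T) × ℝ^d`; weak continuity in `L^1_x`
is continuity of the pairings with all `ψ ∈ L^∞(ℝ^d)`, the dual of `L^1(ℝ^d)`. -/
structure InUniquenessClass {d : ℕ} (T : ℝ) (ρ : ℝ → Space d → ℝ) : Prop where
  bounded : MemLp (fun p : ℝ × Space d => ρ p.1 p.2) ∞
    ((volume.restrict (Ioo 0 T)).prod volume)
  bounded_L1 : ∃ C : ℝ≥0, ∀ᵐ t ∂(volume.restrict (Ioo 0 T)), eLpNorm (ρ t) 1 volume ≤ C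
  mem_L1 : ∀ t ∈ Ico 0 T, MemLp (ρ t) 1 volume
  weakly_continuous : ∀ ψ : Space d → ℝ, MemLp ψ ∞ volume →
    ContinuousOn (fun t => ∫ x, ρ t x * ψ x) (Ico 0 T)

/-- Test functions in `C_c^∞([0, T) × ℝ^d)`, given by a smooth extension to negative times. -/
structure IsTestFunction {d : ℕ} (T : ℝ) (φ : ℝ × Space d → ℝ) : Prop where
  smooth : ContDiff ℝ (⊤ : ℕ∞) φ
  compact_support : HasCompactSupport φ
  support_subset : tsupport φ ⊆ Iio T ×ˢ univ

/-- Distributional solutions on `[0, T) × ℝ^d`, with initial datum `ρ0`, of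
`∂_t ρ - D Δ ρ - div (ρ ∇ Φ(ρ)) = 0`, `Φ(ρ) = -δ Δ[ω ⋆ ω ⋆ ρ]`. -/
def IsDistributionalSolution {d : ℕ} (T D δ : ℝ) (ω ρ0 : Space d → ℝ)
    (ρ : ℝ → Space d → ℝ) : Prop :=
  ∀ φ : ℝ × Space d → ℝ, IsTestFunction T φ →
    (-∫ x, ρ0 x * φ (0, x)) - ∫ t in Ioo 0 T, ∫ x, ρ t x * deriv (fun s => φ (s, x)) t =
      D * (∫ t in Ioo 0 T, ∫ x, ρ t x * Laplacian.laplacian (fun y => φ (t, y)) x) -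
        ∫ t in Ioo 0 T, ∫ x, ρ t x *
          inner ℝ (gradient (potential δ ω (ρ t)) x) (gradient (fun y => φ (t, y)) x)

end NonlocalCahnHilliard

end

/-! Two solutions are compared through the supremum norm of the Fourier transform of their
difference. In this norm the diffusion is an explicit damping and the nonlinearity is Lipschitz, so
a weighted contraction gives uniqueness on all of `[0, T)` at once.

Regularity of the kernel. On the Fourier side `∇Φ(u)` is a multiplier of size a constant times `‖ξ‖
^ 3 * ‖ω̂ ξ‖ ^ 2`. Pairing `ω ∈ L¹` with four derivatives of a mollified `ω`, which are bounded
because `ω ∈ W^{4,∞}`, bounds `∫ (ξ i) ^ 4 * ‖ω̂‖ ^ 2` uniformly in the mollification, and Fatou's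
lemma removes the mollifier (`IsShortRangeKernel.integrable_coord_pow_mul`). Hence `driftConst` is a
convergent integral and `∇Φ(u)` is an absolutely convergent Fourier integral for every `u ∈ L¹`
(`inner_gradient_potential`).

Nonlinearity. Tested against a plane wave of frequency `ξ`, the term `u ∇Φ(u)` becomes an integral
over `η` of the multiplier times `û η` times a combination of `û (-η - ξ)` and `û (ξ - η)`. It is
quadratic in `û`, so with `L¹` norms at most `C` it is Lipschitz in `sup ‖û‖`
(`abs_driftPairing_sub_le`). The same formula shows that weak continuity in `L¹` makes the nonlinear
term continuous in time.

Contraction. Cut-offs extend the weak formulation to plane waves, and the difference `z` of the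
Fourier transforms then solves, at each frequency, a linear equation with damping `4π²D‖ξ‖²`, zero
initial value and a forcing of order `‖ξ‖ * sup ‖z‖` (`integral_sub_eq`). With the weight `exp (μ
t)`, Duhamel's formula divides the forcing by `4π²D‖ξ‖² + μ`; for large `μ` this absorbs the factor
`‖ξ‖` uniformly in `ξ`, and any bound on `z` can be halved (`norm_realFourier_sub_le_half`).
Iterating from the bound `2C` gives `z = 0`, and the Fourier transform is injective on `L¹`. -/

open scoped FourierTransform

noncomputable section

namespace NonlocalCahnHilliard

variable {d : ℕ}

/-! ### Weak derivatives and basic Fourier identities. -/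

/-- The classical partial derivative in the `i`-th coordinate direction. -/
def partialDeriv (i : Fin d) (η : Space d → ℝ) : Space d → ℝ :=
  fun x => fderiv ℝ η x (EuclideanSpace.single i 1)

/-- The Fourier transform of a real-valued function. -/
def realFourier (u : Space d → ℝ) : Space d → ℂ := 𝓕 (fun x => (u x : ℂ))

lemma ContDiff.partialDeriv {i : Fin d} {η : Space d → ℝ} (h : ContDiff ℝ (⊤ : ℕ∞) η) :
    ContDiff ℝ (⊤ : ℕ∞) (partialDeriv i η) :=
  (h.fderiv_right (m := (⊤ : ℕ∞)) (by simp)).clm_apply contDiff_const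

lemma HasCompactSupport.partialDeriv {i : Fin d} {η : Space d → ℝ} (h : HasCompactSupport η) :
    HasCompactSupport (partialDeriv i η) :=
  (h.fderiv ℝ).comp_left (g := fun L : Space d →L[ℝ] ℝ => L (EuclideanSpace.single i 1)) (by simp)

lemma contDiff_iterate_partialDeriv {i : Fin d} {η : Space d → ℝ} (h : ContDiff ℝ (⊤ : ℕ∞) η)
    (k : ℕ) : ContDiff ℝ (⊤ : ℕ∞) ((partialDeriv i)^[k] η) := by
  induction k with
  | zero => exact h
  | succ k ih => rw [Function.iterate_succ_apply']; exact ContDiff.partialDeriv ih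

lemma hasCompactSupport_iterate_partialDeriv {i : Fin d} {η : Space d → ℝ}
    (h : HasCompactSupport η) (k : ℕ) : HasCompactSupport ((partialDeriv i)^[k] η) := by
  induction k with
  | zero => exact h
  | succ k ih => rw [Function.iterate_succ_apply']; exact HasCompactSupport.partialDeriv ih

lemma abs_integral_mul_le_of_ae_bound {f η : Space d → ℝ} {M : ℝ} (hf : ∀ᵐ x, |f x| ≤ M)
    (hη : Integrable η) : |∫ x, f x * η x| ≤ M * ∫ x, |η x| := by
  rw [← integral_const_mul, ← Real.norm_eq_abs]
  refine norm_integral_le_of_norm_le (hη.abs.const_mul M) ?_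
  filter_upwards [hf] with x hx
  rw [Real.norm_eq_abs, abs_mul]
  gcongr

lemma _root_.MeasureTheory.MemLp.exists_ae_abs_le {f : Space d → ℝ} (hf : MemLp f ∞ volume) :
    ∃ M : ℝ, 0 ≤ M ∧ ∀ᵐ x, |f x| ≤ M :=
  ⟨(eLpNormEssSup f volume).toReal, ENNReal.toReal_nonneg, by
    have h := hf.2
    rw [eLpNorm_exponent_top] at h
    filter_upwards [ae_le_eLpNormEssSup (f := f) (μ := volume)] with x hx
    have := ENNReal.toReal_mono h.ne hx
    simpa using this⟩

/-- For `f` in `W^{k,∞}`, integration against `k`-fold derivatives is bounded by the `L¹` norm. -/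
lemma MemSobolevInfty.abs_integral_mul_iterate_partialDeriv_le (i : Fin d) :
    ∀ {k : ℕ} {f : Space d → ℝ}, MemSobolevInfty k f → ∃ M : ℝ, 0 ≤ M ∧
      ∀ η : Space d → ℝ, ContDiff ℝ (⊤ : ℕ∞) η → HasCompactSupport η →
        |∫ x, f x * (partialDeriv i)^[k] η x| ≤ M * ∫ x, |η x|
  | 0, f, hf => by
    obtain ⟨M, hM0, hM⟩ := MemLp.exists_ae_abs_le hf
    exact ⟨M, hM0, fun η h1 h2 => abs_integral_mul_le_of_ae_bound hM
      (h1.continuous.integrable_of_hasCompactSupport h2)⟩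
  | k + 1, f, hf => by
    obtain ⟨g, hg, hgk⟩ := hf.2 i
    obtain ⟨M, hM0, hM⟩ := abs_integral_mul_iterate_partialDeriv_le i hgk
    refine ⟨M, hM0, fun η h1 h2 => ?_⟩
    rw [Function.iterate_succ_apply']
    have := hg.2.2 _ (contDiff_iterate_partialDeriv (i := i) h1 k)
      (hasCompactSupport_iterate_partialDeriv h2 k)
    simp only [partialDeriv] at this ⊢
    rw [this, abs_neg]
    exact hM η h1 h2

lemma iterate_partialDeriv_reflect (i : Fin d) (x : Space d) {η : Space d → ℝ}
    (h : ContDiff ℝ (⊤ : ℕ∞) η) (k : ℕ) :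
    (partialDeriv i)^[k] (fun y => η (x - y)) =
      fun y => (-1) ^ k * (partialDeriv i)^[k] η (x - y) := by
  induction k with
  | zero => simp
  | succ k ih =>
    rw [Function.iterate_succ_apply', ih, Function.iterate_succ_apply']
    ext y
    have h1 : HasFDerivAt ((partialDeriv i)^[k] η) (fderiv ℝ ((partialDeriv i)^[k] η) (x - y))
      (x - y) := ((contDiff_iterate_partialDeriv h k).differentiable (by simp) _).hasFDerivAt
    have h2 := (h1.comp y ((hasFDerivAt_id y).const_sub x)).const_mul ((-1) ^ k)
    simp only [partialDeriv]
    erw [h2.fderiv]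
    simp [pow_succ]

lemma realFourier_partialDeriv (i : Fin d) {η : Space d → ℝ} (h : ContDiff ℝ (⊤ : ℕ∞) η)
    (h' : HasCompactSupport η) (ξ : Space d) :
    realFourier (partialDeriv i η) ξ = (2 * Real.pi * Complex.I * (ξ i : ℂ)) * realFourier η ξ := by
  have hc : ContDiff ℝ (⊤ : ℕ∞) (fun x => (η x : ℂ)) := Complex.ofRealCLM.contDiff.comp h
  have hs : HasCompactSupport (fun x => (η x : ℂ)) := h'.comp_left (g := fun y : ℝ => (y : ℂ)) (by simp)
  have hd := hc.differentiable (by simp)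
  have hcd : Continuous (fderiv ℝ (fun x => (η x : ℂ))) := hc.continuous_fderiv (by simp)
  have hi : Integrable (fderiv ℝ (fun x => (η x : ℂ))) :=
    hcd.integrable_of_hasCompactSupport (hs.fderiv ℝ)
  have key := Real.fourier_fderiv (hc.continuous.integrable_of_hasCompactSupport hs) hd hi
  have key2 := congrArg (fun L => L (EuclideanSpace.single i (1 : ℝ))) (congrFun key ξ)
  rw [Real.fourier_continuousLinearMap_apply hi] at key2
  have h3 : (fun x => ((partialDeriv i η x : ℝ) : ℂ)) =
      fun v => (fderiv ℝ (fun x => (η x : ℂ)) v) (EuclideanSpace.single i (1 : ℝ)) := by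
    ext v
    have := (Complex.ofRealCLM.hasFDerivAt.comp v (h.differentiable (by simp) v).hasFDerivAt)
    have h4 : HasFDerivAt (fun x => (η x : ℂ)) (Complex.ofRealCLM.comp (fderiv ℝ η v)) v := this
    rw [h4.fderiv]
    simp [partialDeriv]
  rw [realFourier, h3, key2, VectorFourier.fourierSMulRight_apply]
  have e : (innerSL ℝ ξ) (EuclideanSpace.single i (1 : ℝ)) = ξ i := by
    rw [innerSL_apply_apply, EuclideanSpace.inner_single_right]; simp
  have e' : ((-innerSL ℝ : Space d →L[ℝ] Space d →L[ℝ] ℝ) ξ) (EuclideanSpace.single i (1 : ℝ)) =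
    -ξ i := by rw [← e]; rfl
  rw [e']
  simp only [realFourier, Complex.real_smul, smul_eq_mul, Complex.ofReal_neg]
  ring

lemma realFourier_iterate_partialDeriv (i : Fin d) {η : Space d → ℝ} (h : ContDiff ℝ (⊤ : ℕ∞) η)
    (h' : HasCompactSupport η) (ξ : Space d) (k : ℕ) :
    realFourier ((partialDeriv i)^[k] η) ξ =
      (2 * Real.pi * Complex.I * (ξ i : ℂ)) ^ k * realFourier η ξ := by
  induction k with
  | zero => simp
  | succ k ih =>
    rw [Function.iterate_succ_apply', realFourier_partialDeriv i
      (contDiff_iterate_partialDeriv h k) (hasCompactSupport_iterate_partialDeriv h' k), ih]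
    ring

lemma integral_fourier_mul_eq_of_integrable {f g : Space d → ℂ} (hf : Integrable f)
    (hg : Integrable g) : ∫ ξ, 𝓕 f ξ * g ξ = ∫ x, f x * 𝓕 g x := by
  have := VectorFourier.integral_fourierIntegral_smul_eq_flip (e := Real.fourierChar)
    (μ := (volume : Measure (Space d))) (ν := (volume : Measure (Space d)))
    (L := innerₗ (Space d)) Real.continuous_fourierChar
    (by simpa using continuous_inner) hf hg
  simp only [flip_innerₗ, smul_eq_mul] at this
  exact this

lemma integral_fourierInv_mul_eq_of_integrable {f g : Space d → ℂ} (hf : Integrable f)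
    (hg : Integrable g) : ∫ ξ, 𝓕⁻ f ξ * g ξ = ∫ x, f x * 𝓕⁻ g x := by
  rw [Real.fourierInv_eq_fourier_comp_neg f, integral_fourier_mul_eq_of_integrable hf.comp_neg hg,
    ← integral_neg_eq_self]
  simp [Real.fourierInv_eq_fourier_neg]

lemma fourierInv_ofReal (u : Space d → ℝ) (ξ : Space d) :
    𝓕⁻ (fun x => (u x : ℂ)) ξ = (starRingEnd ℂ) (realFourier u ξ) := by
  rw [realFourier, Real.fourierInv_eq, Real.fourier_eq, ← integral_conj]
  congr with v
  simp [Circle.smul_def, ← Circle.coe_inv_eq_conj, ← AddChar.map_neg_eq_inv]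

lemma integrable_realFourier_mul_bound {u : Space d → ℝ} (hu : Integrable u) {g : Space d → ℂ}
    (hg : Integrable g) : Integrable (fun ξ => realFourier u ξ * g ξ) := by
  refine hg.bdd_mul (c := ∫ x, ‖u x‖) ?_ ?_
  · exact (VectorFourier.fourierIntegral_continuous Real.continuous_fourierChar
      (L := innerₗ (Space d)) (by simpa using continuous_inner)
      hu.ofReal).aestronglyMeasurable
  · filter_upwards with ξ
    refine (VectorFourier.norm_fourierIntegral_le_integral_norm _ _ _ _ _).trans_eq ?_
    simp

lemma norm_realFourier_le (u : Space d → ℝ) (ξ : Space d) : ‖realFourier u ξ‖ ≤ ∫ x, |u x| := by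
  refine (VectorFourier.norm_fourierIntegral_le_integral_norm _ _ _ _ _).trans_eq ?_
  simp

lemma continuous_realFourier {u : Space d → ℝ} (hu : Integrable u) :
    Continuous (realFourier u) :=
  VectorFourier.fourierIntegral_continuous Real.continuous_fourierChar
      (L := innerₗ (Space d)) (by simpa using continuous_inner) hu.ofReal

lemma ofReal_convolution (f g : Space d → ℝ) (x : Space d) :
    (((f ⋆[ContinuousLinearMap.mul ℝ ℝ, volume] g) x : ℝ) : ℂ) =
      ((fun x => (f x : ℂ)) ⋆[ContinuousLinearMap.mul ℂ ℂ, volume] (fun x => (g x : ℂ))) x := by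
  simp only [convolution, ContinuousLinearMap.mul_apply']
  rw [← integral_complex_ofReal]
  simp

lemma realFourier_convolution {f g : Space d → ℝ} (hf : Integrable f) (hg : Integrable g)
    (ξ : Space d) : realFourier (f ⋆[ContinuousLinearMap.mul ℝ ℝ, volume] g) ξ =
      realFourier f ξ * realFourier g ξ := by
  rw [realFourier, funext (ofReal_convolution f g)]
  exact Real.fourier_mul_convolution_eq hf.ofReal hg.ofReal ξ

lemma integrable_realFourier_of_contDiff {S : Space d → ℝ} (h : ContDiff ℝ (⊤ : ℕ∞) S)
    (h' : HasCompactSupport S) : Integrable (realFourier S) := by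
  have hc : ContDiff ℝ (⊤ : ℕ∞) (fun x => (S x : ℂ)) := Complex.ofRealCLM.contDiff.comp h
  have hs : HasCompactSupport (fun x => (S x : ℂ)) :=
    h'.comp_left (g := fun y : ℝ => (y : ℂ)) (by simp)
  have := (𝓕 (hs.toSchwartzMap hc)).integrable (μ := volume)
  rwa [SchwartzMap.fourier_coe] at this

/-- Parseval identity for the quadratic form of the convolution with a smooth kernel. -/
lemma integral_mul_convolution_eq {u S : Space d → ℝ} (hu : Integrable u)
    (h : ContDiff ℝ (⊤ : ℕ∞) S) (h' : HasCompactSupport S) :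
    ((∫ x, u x * (u ⋆[ContinuousLinearMap.mul ℝ ℝ, volume] S) x : ℝ) : ℂ) =
      ∫ ξ, ((‖realFourier u ξ‖ ^ 2 : ℝ) : ℂ) * realFourier S ξ := by
  have hSi : Integrable S := h.continuous.integrable_of_hasCompactSupport h'
  have hFS : Integrable (realFourier S) := integrable_realFourier_of_contDiff h h'
  set P := u ⋆[ContinuousLinearMap.mul ℝ ℝ, volume] S with hP
  have hPi : Integrable P := hu.integrable_convolution _ hSi
  have hPc : Continuous P := h'.continuous_convolution_right _ hu.locallyIntegrable h.continuous
  have hFP : 𝓕 (fun x => (P x : ℂ)) = fun ξ => realFourier u ξ * realFourier S ξ :=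
    funext (realFourier_convolution hu hSi)
  have hint := integrable_realFourier_mul_bound hu hFS
  have hinv : 𝓕⁻ (fun ξ => realFourier u ξ * realFourier S ξ) = fun x => (P x : ℂ) := by
    rw [← hFP]
    refine Continuous.fourierInv_fourier_eq (by fun_prop) hPi.ofReal ?_
    rw [hFP]; exact hint
  rw [← integral_complex_ofReal]
  have : (fun x => ((u x * P x : ℝ) : ℂ)) =
      fun x => (u x : ℂ) * 𝓕⁻ (fun ξ => realFourier u ξ * realFourier S ξ) x := by
    rw [hinv]; ext x; simp
  rw [this, ← integral_fourierInv_mul_eq_of_integrable (f := fun x => (u x : ℂ)) hu.ofReal hint]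
  congr with ξ
  rw [fourierInv_ofReal, ← mul_assoc, ← Complex.normSq_eq_conj_mul_self, Complex.normSq_eq_norm_sq]

lemma realFourier_even {ζ : Space d → ℝ} (h : ∀ x, ζ (-x) = ζ x) (ξ : Space d) :
    (starRingEnd ℂ) (realFourier ζ ξ) = realFourier ζ ξ := by
  rw [← fourierInv_ofReal, Real.fourierInv_eq_fourier_comp_neg]
  simp [h, realFourier]

/-! ### Weighted integrability of the Fourier transform of the kernel. -/

/-- The convolution at `x` is a pairing of `f` with a derivative of the reflected translate `η (x -
·)`. Reflection costs no sign since the order four is even, and it preserves the `L¹` norm, so the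
bound is uniform in `x`. -/
lemma abs_convolution_iterate_partialDeriv_le {f : Space d → ℝ} {i : Fin d} {M : ℝ}
    (hM : ∀ η : Space d → ℝ, ContDiff ℝ (⊤ : ℕ∞) η → HasCompactSupport η →
      |∫ x, f x * (partialDeriv i)^[4] η x| ≤ M * ∫ x, |η x|)
    {η : Space d → ℝ} (h : ContDiff ℝ (⊤ : ℕ∞) η) (h' : HasCompactSupport η) (x : Space d) :
    |(f ⋆[ContinuousLinearMap.mul ℝ ℝ, volume] ((partialDeriv i)^[4] η)) x| ≤ M * ∫ x, |η x| := by
  have h1 := hM (fun y => η (x - y)) (h.comp (contDiff_const.sub contDiff_id))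
    (h'.comp_homeomorph (Homeomorph.subLeft x))
  rw [integral_sub_left_eq_self (fun y => |η y|) volume x] at h1
  simpa [iterate_partialDeriv_reflect i x h, convolution, show (-1 : ℝ) ^ 4 = 1 by norm_num] using h1

/-- Weighted `L²` bound for the Fourier transform, tested against a mollifier. -/
lemma lintegral_mollified_le {ω : Space d → ℝ} (hω : Integrable ω) {i : Fin d} {M : ℝ}
    (hM : ∀ η : Space d → ℝ, ContDiff ℝ (⊤ : ℕ∞) η → HasCompactSupport η →
      |∫ x, ω x * (partialDeriv i)^[4] η x| ≤ M * ∫ x, |η x|)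
    {ζ : Space d → ℝ} (h : ContDiff ℝ (⊤ : ℕ∞) ζ) (h' : HasCompactSupport ζ)
    (heven : ∀ x, ζ (-x) = ζ x) (hnonneg : ∀ x, 0 ≤ ζ x) (hone : ∫ x, ζ x = 1) :
    ∫⁻ ξ, ENNReal.ofReal
      ((2 * Real.pi * ξ i) ^ 4 * ‖realFourier ω ξ‖ ^ 2 * ‖realFourier ζ ξ‖ ^ 2) ≤
      ENNReal.ofReal (M * ∫ x, |ω x|) := by
  -- Mollifying twice makes the transform of the mollifier `ζ̂ ^ 2`, which is nonnegative because
  -- `ζ̂` is real for even `ζ`, while the `L¹` norm of `η` stays equal to one.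
  set η := ζ ⋆[ContinuousLinearMap.mul ℝ ℝ, volume] ζ with hη
  have hζi : Integrable ζ := h.continuous.integrable_of_hasCompactSupport h'
  have h1 : ContDiff ℝ (⊤ : ℕ∞) η := h'.contDiff_convolution_left _ h hζi.locallyIntegrable
  have h2 : HasCompactSupport η := h'.convolution _ h'
  have hη1 : ∫ x, |η x| = 1 := by
    have : ∀ x, |η x| = η x := fun x => abs_of_nonneg <| integral_nonneg fun y =>
      mul_nonneg (hnonneg _) (hnonneg _)
    simp only [this]
    rw [hη, integral_convolution _ hζi hζi, hone]
    simp
  set S := (partialDeriv i)^[4] η with hS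
  have hS1 : ContDiff ℝ (⊤ : ℕ∞) S := contDiff_iterate_partialDeriv (i := i) h1 4
  have hS2 : HasCompactSupport S := hasCompactSupport_iterate_partialDeriv (i := i) h2 4
  have key := integral_mul_convolution_eq hω hS1 hS2
  set G : Space d → ℝ := fun ξ =>
    (2 * Real.pi * ξ i) ^ 4 * ‖realFourier ω ξ‖ ^ 2 * ‖realFourier ζ ξ‖ ^ 2 with hG
  have hGS : ∀ ξ, ((‖realFourier ω ξ‖ ^ 2 : ℝ) : ℂ) * realFourier S ξ = (G ξ : ℂ) := by
    intro ξ
    rw [hS, realFourier_iterate_partialDeriv i h1 h2, hη, realFourier_convolution hζi hζi]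
    nth_rw 1 [← realFourier_even heven]
    rw [← Complex.normSq_eq_conj_mul_self, Complex.normSq_eq_norm_sq]
    simp only [hG]
    push_cast
    ring_nf
    simp
  have hFS : Integrable (realFourier S) := integrable_realFourier_of_contDiff hS1 hS2
  have hGi : Integrable G := by
    have h3 : Integrable (fun ξ => ((‖realFourier ω ξ‖ ^ 2 : ℝ) : ℂ) * realFourier S ξ) := by
      refine hFS.bdd_mul (c := (∫ x, |ω x|) ^ 2) ?_ ?_
      · have := continuous_realFourier hω
        exact Continuous.aestronglyMeasurable (by fun_prop)
      · filter_upwards with ξ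
        rw [Complex.norm_real, Real.norm_of_nonneg (by positivity)]
        gcongr
        exact norm_realFourier_le _ _
    simp only [hGS] at h3
    exact h3.re
  rw [← ofReal_integral_eq_lintegral_ofReal hGi
    (Eventually.of_forall fun ξ => by simp only [hG, Pi.zero_apply]; positivity)]
  apply ENNReal.ofReal_le_ofReal
  simp only [hGS] at key
  rw [integral_complex_ofReal] at key
  rw [← Complex.ofReal_inj.1 key]
  -- All four derivatives are charged to one copy of `ω`; the other copy only needs to be in `L¹`.
  have h4 : ∀ x, |(ω ⋆[ContinuousLinearMap.mul ℝ ℝ, volume] S) x| ≤ M := fun x => by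
    have := abs_convolution_iterate_partialDeriv_le hM h1 h2 x
    rwa [hη1, mul_one] at this
  rw [← integral_const_mul]
  refine (le_abs_self _).trans ?_
  rw [← Real.norm_eq_abs]
  refine norm_integral_le_of_norm_le (hω.abs.const_mul M) (Eventually.of_forall fun x => ?_)
  rw [Real.norm_eq_abs, abs_mul, mul_comm]
  gcongr
  exact h4 x

/-- A sequence of symmetric bump functions shrinking to the origin. -/
def shrinkingBump (d : ℕ) (n : ℕ) : ContDiffBump (0 : Space d) where
  rIn := 1 / (n + 1 : ℝ) / 2
  rOut := 1 / (n + 1 : ℝ)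
  rIn_pos := by positivity
  rIn_lt_rOut := by
    have : (0 : ℝ) < 1 / (n + 1 : ℝ) := by positivity
    linarith

lemma tendsto_realFourier_shrinkingBump (ξ : Space d) :
    Tendsto (fun n => realFourier ((shrinkingBump d n).normed volume) ξ) atTop (𝓝 1) := by
  have h1 : Tendsto (fun n => (shrinkingBump d n).rOut) atTop (𝓝 0) :=
    tendsto_one_div_add_atTop_nhds_zero_nat
  have hc : Continuous (fun v : Space d => (Real.fourierChar (inner ℝ v ξ) : ℂ)) := by fun_prop
  have h2 := ContDiffBump.convolution_tendsto_right_of_continuous (μ := volume) h1 hc 0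
  simp only [inner_zero_left, AddChar.map_zero_eq_one, Circle.coe_one] at h2
  refine h2.congr fun n => ?_
  rw [realFourier, Real.fourier_eq]
  simp only [convolution, zero_sub, inner_neg_left]
  congr with v
  simp [Circle.smul_def, mul_comm]

/-- The mollified integrals are bounded independently of the mollifier, and the transforms of the
shrinking bumps tend to one pointwise, so Fatou's lemma passes the bound to the limit. -/
lemma IsShortRangeKernel.integrable_coord_pow_mul {ω : Space d → ℝ} (hω : IsShortRangeKernel ω)
    (i : Fin d) : Integrable (fun ξ : Space d => (ξ i) ^ 4 * ‖realFourier ω ξ‖ ^ 2) := by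
  obtain ⟨M, -, hM⟩ := hω.regular.abs_integral_mul_iterate_partialDeriv_le i
  have hcω := continuous_realFourier hω.integrable
  have hcb : ∀ n, Continuous (realFourier ((shrinkingBump d n).normed volume)) := fun n =>
    continuous_realFourier (shrinkingBump d n).integrable_normed
  set F : ℕ → Space d → ℝ≥0∞ := fun n ξ => ENNReal.ofReal
      ((2 * Real.pi * ξ i) ^ 4 * ‖realFourier ω ξ‖ ^ 2 *
        ‖realFourier ((shrinkingBump d n).normed volume) ξ‖ ^ 2) with hF
  have hmeas : ∀ n, Measurable (F n) := fun n => by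
    have := hcb n
    exact ENNReal.measurable_ofReal.comp (Continuous.measurable (by fun_prop))
  have hlim : ∀ ξ : Space d, liminf (fun n => F n ξ) atTop =
      ENNReal.ofReal ((2 * Real.pi * ξ i) ^ 4 * ‖realFourier ω ξ‖ ^ 2) := fun ξ => by
    apply Tendsto.liminf_eq
    apply (ENNReal.continuous_ofReal.tendsto _).comp
    have := ((tendsto_realFourier_shrinkingBump ξ).norm.pow 2).const_mul
      ((2 * Real.pi * ξ i) ^ 4 * ‖realFourier ω ξ‖ ^ 2)
    simpa using this
  have hle : ∫⁻ ξ : Space d, ENNReal.ofReal ((2 * Real.pi * ξ i) ^ 4 * ‖realFourier ω ξ‖ ^ 2) ≤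
      ENNReal.ofReal (M * ∫ x, |ω x|) := by
    simp only [← hlim]
    refine (lintegral_liminf_le hmeas).trans ?_
    refine liminf_le_of_frequently_le' (Frequently.of_forall fun n => ?_)
    exact lintegral_mollified_le hω.integrable hM (shrinkingBump d n).contDiff_normed
      (shrinkingBump d n).hasCompactSupport_normed (shrinkingBump d n).normed_neg
      (shrinkingBump d n).nonneg_normed (shrinkingBump d n).integral_normed
  have hint : Integrable
      (fun ξ : Space d => (2 * Real.pi * ξ i) ^ 4 * ‖realFourier ω ξ‖ ^ 2) := by
    refine ⟨Continuous.aestronglyMeasurable (by fun_prop), ?_⟩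
    rw [hasFiniteIntegral_iff_ofReal (Eventually.of_forall fun ξ => by
      simp only [Pi.zero_apply]; positivity)]
    exact hle.trans_lt ENNReal.ofReal_lt_top
  refine (hint.const_mul ((2 * Real.pi) ^ 4)⁻¹).congr (Eventually.of_forall fun ξ => ?_)
  simp only
  have : (2 * Real.pi) ^ 4 ≠ 0 := by positivity
  field_simp

lemma norm_pow_four_le_sum (ξ : Space d) : ‖ξ‖ ^ 4 ≤ d * ∑ i, (ξ i) ^ 4 := by
  have h := EuclideanSpace.real_norm_sq_eq ξ
  have h2 := sq_sum_le_card_mul_sum_sq (s := (Finset.univ : Finset (Fin d))) (f := fun i => ξ i ^ 2)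
  rw [← h] at h2
  simp only [Finset.card_univ, Fintype.card_fin] at h2
  calc ‖ξ‖ ^ 4 = (‖ξ‖ ^ 2) ^ 2 := by ring
    _ ≤ _ := h2
    _ = _ := by congr 1; exact Finset.sum_congr rfl fun i _ => by ring

/-- Low frequencies are harmless since `ω̂` is continuous, hence bounded on the unit ball; outside
it `‖ξ‖ ^ n ≤ ‖ξ‖ ^ 4`, which the coordinate fourth powers control. The case `n = 3` makes the drift
finite, and `n = 0` gives inversion for `ω ⋆ ω`. -/
lemma IsShortRangeKernel.integrable_norm_pow_mul {ω : Space d → ℝ} (hω : IsShortRangeKernel ω)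
    {n : ℕ} (hn : n ≤ 4) : Integrable (fun ξ : Space d => ‖ξ‖ ^ n * ‖realFourier ω ξ‖ ^ 2) := by
  have hcω := continuous_realFourier hω.integrable
  have h4 : Integrable (fun ξ : Space d => (d * ∑ i, (ξ i) ^ 4) * ‖realFourier ω ξ‖ ^ 2) := by
    have := (integrable_finsetSum Finset.univ
      (fun i _ => hω.integrable_coord_pow_mul i)).const_mul (d : ℝ)
    refine this.congr (Eventually.of_forall fun ξ => ?_)
    simp only [Finset.sum_mul, mul_assoc]
  have h0 : Integrable ((Metric.closedBall (0 : Space d) 1).indicator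
      (fun ξ => ‖realFourier ω ξ‖ ^ 2)) := by
    rw [integrable_indicator_iff Metric.isClosed_closedBall.measurableSet]
    exact Continuous.continuousOn (by fun_prop) |>.integrableOn_compact (isCompact_closedBall _ _)
  refine (h0.add h4).mono' (Continuous.aestronglyMeasurable (by fun_prop))
    (Eventually.of_forall fun ξ => ?_)
  rw [Real.norm_of_nonneg (by positivity), Pi.add_apply]
  have hsum : 0 ≤ ∑ i, (ξ i) ^ 4 := Finset.sum_nonneg fun i _ => by positivity
  by_cases hξ : ‖ξ‖ ≤ 1
  · rw [indicator_of_mem (by simpa using hξ)]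
    have : ‖ξ‖ ^ n * ‖realFourier ω ξ‖ ^ 2 ≤ 1 * ‖realFourier ω ξ‖ ^ 2 := by
      gcongr
      exact pow_le_one₀ (norm_nonneg _) hξ
    have : 0 ≤ (d * ∑ i, (ξ i) ^ 4) * ‖realFourier ω ξ‖ ^ 2 := by positivity
    linarith
  · rw [indicator_of_notMem (by simpa using hξ), zero_add]
    gcongr
    exact (pow_le_pow_right₀ (not_le.1 hξ).le hn).trans (norm_pow_four_le_sum ξ)

/-! ### Fourier inversion and the Fourier representation of the drift. -/

lemma continuous_fourierInv {h : Space d → ℂ} (hh : Integrable h) : Continuous (𝓕⁻ h) := by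
  rw [Real.fourierInv_eq_fourier_comp_neg]
  exact VectorFourier.fourierIntegral_continuous Real.continuous_fourierChar
      (L := innerₗ (Space d)) (by simpa using continuous_inner) hh.comp_neg

/-- Fourier inversion almost everywhere for an integrable function with integrable transform. -/
lemma ae_eq_fourierInv_fourier {g : Space d → ℂ} (hg : Integrable g) (hFg : Integrable (𝓕 g)) :
    g =ᵐ[volume] 𝓕⁻ (𝓕 g) := by
  -- By duality: both transforms are moved onto a smooth compactly supported test function, where
  -- inversion is the Schwartz statement.
  refine ae_eq_of_integral_contDiff_smul_eq hg.locallyIntegrable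
    (continuous_fourierInv hFg).locallyIntegrable fun φ h1 h2 => ?_
  have hc : ContDiff ℝ (⊤ : ℕ∞) (fun x => (φ x : ℂ)) := Complex.ofRealCLM.contDiff.comp h1
  have hs : HasCompactSupport (fun x => (φ x : ℂ)) :=
    h2.comp_left (g := fun y : ℝ => (y : ℂ)) (by simp)
  set S := hs.toSchwartzMap hc with hS
  have hS0 : (fun x => (φ x : ℂ)) = S := rfl
  have hFS : Integrable (𝓕⁻ (S : Space d → ℂ)) := by
    have := (𝓕⁻ S).integrable (μ := volume)
    rwa [SchwartzMap.fourierInv_coe] at this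
  have hinv : 𝓕 (𝓕⁻ (S : Space d → ℂ)) = S := by
    rw [← SchwartzMap.fourierInv_coe, ← SchwartzMap.fourier_coe]; simp
  have h3 := integral_fourierInv_mul_eq_of_integrable hFg S.integrable
  rw [integral_fourier_mul_eq_of_integrable hg hFS, hinv] at h3
  have h4 : ∀ f : Space d → ℂ, ∫ x, φ x • f x = ∫ x, f x * S x := fun f => by
    congr with x
    rw [← hS0]; simp [mul_comm]
  rw [h4, h4, h3]

lemma ae_eq_zero_of_realFourier_eq_zero {u : Space d → ℝ} (hu : Integrable u)
    (h : ∀ ξ, realFourier u ξ = 0) : u =ᵐ[volume] 0 := by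
  have h0 : 𝓕 (fun x => (u x : ℂ)) = 0 := funext h
  have := ae_eq_fourierInv_fourier (g := fun x => (u x : ℂ)) hu.ofReal
    (by rw [h0]; exact integrable_zero _ _ _)
  filter_upwards [this] with x hx
  rw [h0, Real.fourierInv_eq] at hx
  simpa using hx

/-- Associativity holds at every point, not only almost everywhere: `ω` is bounded and `|ω| ⋆ |u|`
is integrable, so the outermost convolution converges for each `x`. Pointwise equality is needed
because the result is differentiated. -/
lemma convolution_self_assoc {ω u : Space d → ℝ} (hω : Integrable ω) {M : ℝ}
    (hM : ∀ᵐ x, |ω x| ≤ M) (hu : Integrable u) (x : Space d) :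
    (ω ⋆[ContinuousLinearMap.mul ℝ ℝ, volume] (ω ⋆[ContinuousLinearMap.mul ℝ ℝ, volume] u)) x =
    ((ω ⋆[ContinuousLinearMap.mul ℝ ℝ, volume] ω) ⋆[ContinuousLinearMap.mul ℝ ℝ, volume] u) x := by
  symm
  refine convolution_assoc _ _ _ _ (fun x y z => by simp [mul_assoc]) hω.1 hω.1 hu.1
    (hω.ae_convolution_exists _ hω) (hω.norm.ae_convolution_exists _ hu.norm) ?_
  have h1 := hω.norm.integrable_convolution (ContinuousLinearMap.mul ℝ ℝ) hu.norm
  refine (h1.comp_sub_left x).bdd_mul (c := M) hω.norm.1 ?_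
  simpa using hM

lemma realFourier_sq_integrable {ω : Space d → ℝ} (hω : IsShortRangeKernel ω) :
    Integrable (fun ξ => realFourier ω ξ * realFourier ω ξ) := by
  have h := hω.integrable_norm_pow_mul (n := 0) (by norm_num)
  have hc := continuous_realFourier hω.integrable
  refine h.mono' (Continuous.aestronglyMeasurable (by fun_prop)) (Eventually.of_forall fun ξ => ?_)
  simp [sq]

lemma fourierInv_reflect (u : Space d → ℝ) (x ξ : Space d) :
    𝓕⁻ (fun t => (u (x - t) : ℂ)) ξ = Real.fourierChar (inner ℝ ξ x) • realFourier u ξ := by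
  rw [realFourier, Real.fourierInv_eq, Real.fourier_eq,
    ← integral_sub_left_eq_self _ volume x, Circle.smul_def, ← integral_smul]
  congr with v
  rw [← Circle.smul_def]
  rw [smul_smul, ← AddChar.map_add_eq_mul, inner_sub_left, real_inner_comm x ξ, sub_sub_cancel]
  rfl

/-- Frequency-side representation of the doubly regularised density. -/
lemma convolution_convolution_eq_fourierInv {ω u : Space d → ℝ} (hω : IsShortRangeKernel ω)
    (hu : Integrable u) (x : Space d) :
    (((ω ⋆[ContinuousLinearMap.mul ℝ ℝ, volume] (ω ⋆[ContinuousLinearMap.mul ℝ ℝ, volume] u)) x : ℝ)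
      : ℂ) = 𝓕⁻ (fun ξ => realFourier ω ξ * realFourier ω ξ * realFourier u ξ) x := by
  obtain ⟨M, -, hM⟩ := MemLp.exists_ae_abs_le hω.regular.1
  have hm := realFourier_sq_integrable hω
  rw [convolution_self_assoc hω.integrable hM hu]
  set c := ω ⋆[ContinuousLinearMap.mul ℝ ℝ, volume] ω with hc
  have hci : Integrable c := hω.integrable.integrable_convolution _ hω.integrable
  have hF : 𝓕 (fun x => (c x : ℂ)) = fun ξ => realFourier ω ξ * realFourier ω ξ :=
    funext (realFourier_convolution hω.integrable hω.integrable)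
  have hae := ae_eq_fourierInv_fourier (g := fun x => (c x : ℂ)) hci.ofReal (by rw [hF]; exact hm)
  rw [hF] at hae
  rw [ofReal_convolution]
  simp only [convolution, ContinuousLinearMap.mul_apply']
  have h1 : ∫ t, (c t : ℂ) * (u (x - t) : ℂ) =
      ∫ t, 𝓕⁻ (fun ξ => realFourier ω ξ * realFourier ω ξ) t * (u (x - t) : ℂ) := by
    -- Inversion for `ω ⋆ ω` is only known almost everywhere, which suffices under the integral in
    -- `t` and yields an identity at every `x`.
    refine integral_congr_ae ?_
    filter_upwards [hae] with t ht
    rw [ht]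
  rw [h1, integral_fourierInv_mul_eq_of_integrable hm
    (g := fun t => (u (x - t) : ℂ)) (hu.comp_sub_left x).ofReal, Real.fourierInv_eq]
  congr with ξ
  rw [fourierInv_reflect, Circle.smul_def, Circle.smul_def, smul_eq_mul, smul_eq_mul]
  ring

lemma norm_realFourier_integrable_bound {ω u : Space d → ℝ} (hω : IsShortRangeKernel ω)
    (hu : Integrable u) {n : ℕ} (hn : n ≤ 4) :
    Integrable (fun ξ => ‖ξ‖ ^ n * ‖realFourier ω ξ * realFourier ω ξ * realFourier u ξ‖) := by
  have h := (hω.integrable_norm_pow_mul hn).mul_const (∫ x, |u x|)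
  have hc := continuous_realFourier hω.integrable
  have hc' := continuous_realFourier hu
  refine h.mono' (Continuous.aestronglyMeasurable (by fun_prop)) (Eventually.of_forall fun ξ => ?_)
  rw [Real.norm_of_nonneg (by positivity), norm_mul, norm_mul, ← sq, ← mul_assoc]
  gcongr
  exact norm_realFourier_le u ξ

lemma contDiff_fourierInv {h : Space d → ℂ} {N : ℕ}
    (hh : ∀ n ≤ N, Integrable (fun ξ => ‖ξ‖ ^ n * ‖h ξ‖)) : ContDiff ℝ N (𝓕⁻ h) := by
  rw [Real.fourierInv_eq_fourier_comp_neg]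
  refine mod_cast Real.contDiff_fourier (N := N) fun n hn => ?_
  have := (hh n (by exact_mod_cast hn)).comp_neg
  simpa using this

lemma fderiv_fourierInv_apply {h : Space d → ℂ} (h0 : Integrable h)
    (h1 : Integrable (fun ξ => ‖ξ‖ * ‖h ξ‖)) (x v : Space d) :
    fderiv ℝ (𝓕⁻ h) x v = 𝓕⁻ (fun ξ => 2 * Real.pi * Complex.I * (inner ℝ v ξ : ℝ) * h ξ) x := by
  rw [Real.fourierInv_eq_fourier_comp_neg, Real.fourierInv_eq_fourier_comp_neg]
  have h1' : Integrable (fun ξ => ‖ξ‖ * ‖h (-ξ)‖) := by simpa using h1.comp_neg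
  rw [Real.fderiv_fourier h0.comp_neg h1', Real.fourier_continuousLinearMap_apply]
  · refine congrArg (fun g : Space d → ℂ => 𝓕 g x) (funext fun ξ => ?_)
    rw [VectorFourier.fourierSMulRight_apply, innerSL_apply_apply, real_inner_comm]
    simp [mul_assoc]
  · have := h1'.const_mul (2 * Real.pi * ‖innerSL (E := Space d) ℝ‖)
    refine this.mono' (h0.comp_neg.1.fourierSMulRight) (Eventually.of_forall fun ξ => ?_)
    refine (VectorFourier.norm_fourierSMulRight_le _ _ _).trans_eq (by ring)

lemma laplacian_eq_sum_fderiv {F : Type*} [NormedAddCommGroup F] [NormedSpace ℝ F]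
    {f : Space d → F} (hf : ContDiff ℝ 2 f) (x : Space d) :
    Laplacian.laplacian f x = ∑ i, fderiv ℝ
      (fun y => fderiv ℝ f y (EuclideanSpace.single i 1)) x (EuclideanSpace.single i 1) := by
  rw [InnerProductSpace.laplacian_eq_iteratedFDeriv_orthonormalBasis f
    (EuclideanSpace.basisFun (Fin d) ℝ)]
  refine Finset.sum_congr rfl fun i _ => ?_
  have h1 : DifferentiableAt ℝ (fderiv ℝ f) x :=
    (hf.fderiv_right (m := 1) (by norm_num)).differentiable (by norm_num) x
  rw [iteratedFDeriv_two_apply, fderiv_clm_apply h1 (by fun_prop)]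
  simp

lemma laplacian_fourierInv {h : Space d → ℂ}
    (hm : AEStronglyMeasurable h volume)
    (hh : ∀ n ≤ 2, Integrable (fun ξ => ‖ξ‖ ^ n * ‖h ξ‖)) (x : Space d) :
    Laplacian.laplacian (𝓕⁻ h : Space d → ℂ) x =
      𝓕⁻ (fun ξ => -(4 * Real.pi ^ 2 * ‖ξ‖ ^ 2 : ℝ) * h ξ) x := by
  have hint : ∀ n ≤ 2, ∀ g : Space d → ℂ, AEStronglyMeasurable g volume → ∀ C : ℝ,
      (∀ ξ, ‖g ξ‖ ≤ C * (‖ξ‖ ^ n * ‖h ξ‖)) → Integrable g := fun n hn g hg C hC =>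
    ((hh n hn).const_mul C).mono' hg (Eventually.of_forall hC)
  have h0 : Integrable h := hint 0 (by norm_num) h hm 1 (by simp)
  have h1 : Integrable (fun ξ => ‖ξ‖ * ‖h ξ‖) := by simpa using hh 1 (by norm_num)
  rw [laplacian_eq_sum_fderiv (contDiff_fourierInv (N := 2) hh)]
  have hle : ∀ (i : Fin d) (ξ : Space d),
      |(inner ℝ (EuclideanSpace.single i (1 : ℝ)) ξ : ℝ)| ≤ ‖ξ‖ := fun i ξ => by
    simpa using abs_real_inner_le_norm (EuclideanSpace.single i (1 : ℝ)) ξ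
  have hle2 : ∀ (i : Fin d) (ξ : Space d) (z : ℂ), ‖2 * Real.pi * Complex.I *
      (inner ℝ (EuclideanSpace.single i (1 : ℝ)) ξ : ℝ) * z‖ ≤ 2 * Real.pi * ‖ξ‖ * ‖z‖ :=
    fun i ξ z => by
      have := hle i ξ
      rw [norm_mul, norm_mul, norm_mul, norm_mul, Complex.norm_real, Complex.norm_real,
        Complex.norm_I, Real.norm_eq_abs, Real.norm_eq_abs, abs_of_pos Real.pi_pos,
        Complex.norm_ofNat, mul_one]
      gcongr
  have hmeas : ∀ i : Fin d, AEStronglyMeasurable (fun ξ : Space d => 2 * Real.pi * Complex.I *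
      (inner ℝ (EuclideanSpace.single i (1 : ℝ)) ξ : ℝ)) volume := fun i =>
    Continuous.aestronglyMeasurable (by fun_prop)
  have hi0 : ∀ i : Fin d, Integrable (fun ξ : Space d => 2 * Real.pi * Complex.I *
      (inner ℝ (EuclideanSpace.single i (1 : ℝ)) ξ : ℝ) * h ξ) := fun i => by
    refine hint 1 (by norm_num) _ ((hmeas i).mul hm) (2 * Real.pi) fun ξ => ?_
    rw [pow_one, ← mul_assoc]
    exact hle2 i ξ _
  have hi1 : ∀ i : Fin d, Integrable (fun ξ : Space d => ‖ξ‖ * ‖2 * Real.pi * Complex.I *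
      (inner ℝ (EuclideanSpace.single i (1 : ℝ)) ξ : ℝ) * h ξ‖) := fun i => by
    refine ((hh 2 le_rfl).const_mul (2 * Real.pi)).mono'
      (continuous_norm.aestronglyMeasurable.mul ((hmeas i).mul hm).norm)
      (Eventually.of_forall fun ξ => ?_)
    rw [Real.norm_of_nonneg (by positivity)]
    exact (mul_le_mul_of_nonneg_left (hle2 i ξ (h ξ)) (norm_nonneg ξ)).trans_eq (by ring)
  have hstep : ∀ i : Fin d, fderiv ℝ
      (fun y => fderiv ℝ (𝓕⁻ h) y (EuclideanSpace.single i 1)) x (EuclideanSpace.single i 1) =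
      𝓕⁻ (fun ξ => 2 * Real.pi * Complex.I * (inner ℝ (EuclideanSpace.single i (1 : ℝ)) ξ : ℝ) *
        (2 * Real.pi * Complex.I * (inner ℝ (EuclideanSpace.single i (1 : ℝ)) ξ : ℝ) * h ξ)) x :=
    fun i => by
      rw [funext fun y => fderiv_fourierInv_apply h0 h1 y (EuclideanSpace.single i 1)]
      exact fderiv_fourierInv_apply (hi0 i) (hi1 i) x _
  simp only [hstep, Real.fourierInv_eq]
  rw [← integral_finsetSum]
  · congr with ξ
    rw [← Finset.smul_sum]
    congr 1
    have : ((‖ξ‖ : ℂ)) ^ 2 = ∑ i, (ξ i : ℂ) ^ 2 := by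
      exact_mod_cast congrArg (fun r : ℝ => (r : ℂ)) (EuclideanSpace.real_norm_sq_eq ξ)
    push_cast
    rw [this, Finset.mul_sum, ← Finset.sum_neg_distrib, Finset.sum_mul]
    refine Finset.sum_congr rfl fun i _ => ?_
    rw [EuclideanSpace.inner_single_left]
    simp only [map_one, one_mul]
    ring_nf
    rw [Complex.I_sq]
    ring
  · intro i _
    have : Integrable (fun ξ : Space d => 2 * Real.pi * Complex.I *
      (inner ℝ (EuclideanSpace.single i (1 : ℝ)) ξ : ℝ) * (2 * Real.pi * Complex.I *
      (inner ℝ (EuclideanSpace.single i (1 : ℝ)) ξ : ℝ) * h ξ)) := by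
      refine ((hi1 i).const_mul (2 * Real.pi)).mono' ((hmeas i).mul ((hmeas i).mul hm))
        (Eventually.of_forall fun ξ => ?_)
      exact (hle2 i ξ _).trans_eq (by ring)
    have := (Real.fourierIntegral_convergent_iff (-x)).2 this
    simpa using this

/-- The Fourier multiplier giving the gradient of the potential. -/
def driftSymbol (δ : ℝ) (ω : Space d → ℝ) (ξ : Space d) : ℂ :=
  2 * Real.pi * Complex.I * (δ * (4 * Real.pi ^ 2 * ‖ξ‖ ^ 2 : ℝ)) *
    (realFourier ω ξ * realFourier ω ξ)

lemma potential_eq_re_fourierInv {ω u : Space d → ℝ} (δ : ℝ) (hω : IsShortRangeKernel ω)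
    (hu : Integrable u) (x : Space d) :
    potential δ ω u x = (𝓕⁻ (fun ξ => δ * (4 * Real.pi ^ 2 * ‖ξ‖ ^ 2 : ℝ) *
      (realFourier ω ξ * realFourier ω ξ * realFourier u ξ)) x).re := by
  set h : Space d → ℂ := fun ξ => realFourier ω ξ * realFourier ω ξ * realFourier u ξ with hh
  have hc := continuous_realFourier hω.integrable
  have hc' := continuous_realFourier hu
  have hcont : Continuous h := by fun_prop
  have hb : ∀ n ≤ 2, Integrable (fun ξ => ‖ξ‖ ^ n * ‖h ξ‖) := fun n hn =>
    norm_realFourier_integrable_bound hω hu (by omega)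
  have hf : (ω ⋆[ContinuousLinearMap.mul ℝ ℝ, volume]
      (ω ⋆[ContinuousLinearMap.mul ℝ ℝ, volume] u)) = Complex.reCLM ∘ (𝓕⁻ h) := by
    ext y
    rw [Function.comp_apply, ← convolution_convolution_eq_fourierInv hω hu y]
    simp
  rw [potential, hf, (contDiff_fourierInv (N := 2) hb).contDiffAt.laplacian_CLM_comp_left,
    Function.comp_apply, laplacian_fourierInv hcont.aestronglyMeasurable hb,
    Complex.reCLM_apply, ← Complex.re_ofReal_mul, Real.fourierInv_eq, Real.fourierInv_eq,
    ← integral_const_mul]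
  congr 2 with ξ
  simp only [Circle.smul_def, smul_eq_mul]
  push_cast
  ring

/-- The gradient of the potential as an absolutely convergent Fourier integral. -/
lemma inner_gradient_potential {ω u : Space d → ℝ} (δ : ℝ) (hω : IsShortRangeKernel ω)
    (hu : Integrable u) (x v : Space d) :
    inner ℝ (gradient (potential δ ω u) x) v =
      (∫ ξ, Real.fourierChar (inner ℝ ξ x) •
        ((inner ℝ v ξ : ℝ) * driftSymbol δ ω ξ * realFourier u ξ)).re := by
  set h : Space d → ℂ := fun ξ => δ * (4 * Real.pi ^ 2 * ‖ξ‖ ^ 2 : ℝ) *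
      (realFourier ω ξ * realFourier ω ξ * realFourier u ξ) with hh
  have hc := continuous_realFourier hω.integrable
  have hc' := continuous_realFourier hu
  have hcont : Continuous h := by fun_prop
  have hnorm : ∀ ξ, ‖h ξ‖ = |δ| * (4 * Real.pi ^ 2) *
      (‖ξ‖ ^ 2 * ‖realFourier ω ξ * realFourier ω ξ * realFourier u ξ‖) := fun ξ => by
    simp only [hh]
    rw [norm_mul, norm_mul, Complex.norm_real, Complex.norm_real, Real.norm_eq_abs,
      Real.norm_of_nonneg (by positivity)]
    ring
  have h0 : Integrable h := by
    rw [← integrable_norm_iff hcont.aestronglyMeasurable]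
    simp only [hnorm]
    exact (norm_realFourier_integrable_bound hω hu (by norm_num)).const_mul _
  have h1 : Integrable (fun ξ => ‖ξ‖ * ‖h ξ‖) := by
    refine ((norm_realFourier_integrable_bound hω hu (n := 3) (by norm_num)).const_mul
      (|δ| * (4 * Real.pi ^ 2))).congr (Eventually.of_forall fun ξ => ?_)
    simp only [hnorm]
    ring
  have hfun : potential δ ω u = Complex.reCLM ∘ (𝓕⁻ h) :=
    funext fun y => potential_eq_re_fourierInv δ hω hu y
  have hdiff : Differentiable ℝ (𝓕⁻ h) := by
    refine (contDiff_fourierInv (N := 1) fun n hn => ?_).differentiable (by norm_num)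
    interval_cases n
    · simpa using h0.norm
    · simpa using h1
  rw [gradient, InnerProductSpace.toDual_symm_apply, hfun,
    fderiv_comp x Complex.reCLM.differentiableAt (hdiff x), ContinuousLinearMap.fderiv,
    ContinuousLinearMap.comp_apply, fderiv_fourierInv_apply h0 h1, Real.fourierInv_eq,
    Complex.reCLM_apply]
  congr 2 with ξ
  simp only [hh, driftSymbol]
  congr 1
  ring

/-! ### From weak formulations in time to integral equations. -/

/-- A strict violation at `t` persists on a relatively open neighbourhood, which meets `Ioo 0 T` in
a nonempty open set even for `t = 0`, and such a set is not null. -/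
lemma le_of_ae_le_of_continuousOn {T C : ℝ} {f : ℝ → ℝ} (hf : ContinuousOn f (Ico 0 T))
    (h : ∀ᵐ s ∂(volume.restrict (Ioo 0 T)), f s ≤ C) : ∀ t ∈ Ico 0 T, f t ≤ C := by
  intro t ht
  by_contra! hlt
  have h1 : ∀ᶠ s in 𝓝[Ico 0 T] t, C < f s := (hf t ht).eventually_const_lt hlt
  obtain ⟨U, hU, htU, hUs⟩ := mem_nhdsWithin.1 h1
  have h2 : volume (U ∩ Ioo 0 T) = 0 := by
    rw [ae_restrict_iff' measurableSet_Ioo] at h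
    refine measure_mono_null (fun s hs => ?_) h
    simp only [mem_compl_iff, mem_ofPred_eq, Classical.not_imp, not_le]
    exact ⟨hs.2, hUs ⟨hs.1, Ioo_subset_Ico_self hs.2⟩⟩
  have h3 := (hU.inter isOpen_Ioo).eq_empty_of_measure_zero h2
  have h4 : t ∈ closure (Ioo 0 T) := by
    rw [closure_Ioo (ht.1.trans_lt ht.2).ne]
    exact Ico_subset_Icc_self ht
  obtain ⟨s, hs⟩ := mem_closure_iff.1 h4 U hU htU
  simp [h3] at hs

/-- Integrating `g` backwards from `T` gives a primitive that vanishes near `T` but need not vanish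
at `0`. Admitting such test functions is what encodes the initial value in the weak formulation. -/
lemma exists_primitive_test_function {T : ℝ} (hT : 0 < T) {g : ℝ → ℝ}
    (hg : ContDiff ℝ (⊤ : ℕ∞) g) (hc : HasCompactSupport g) (hs : tsupport g ⊆ Ioo 0 T) :
    ∃ θ : ℝ → ℝ, ContDiff ℝ (⊤ : ℕ∞) θ ∧ HasCompactSupport θ ∧ tsupport θ ⊆ Iio T ∧
      ∀ t ∈ Ioo 0 T, HasDerivAt θ (g t) t := by
  obtain ⟨b, hbT, hb⟩ : ∃ b < T, tsupport g ⊆ Iic b := by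
    rcases (tsupport g).eq_empty_or_nonempty with h | h
    · exact ⟨T - 1, by linarith, by simp [h]⟩
    · obtain ⟨m, hm, hm'⟩ := hc.isCompact.exists_isGreatest h
      exact ⟨m, (hs hm).2, fun x hx => hm' hx⟩
  have hg0 : ∀ x, b < x → g x = 0 := fun x hx => by
    by_contra hne
    exact absurd (hb (subset_tsupport g hne)) (not_le.2 hx)
  set Θ : ℝ → ℝ := fun t => ∫ s in T..t, g s with hΘ
  have hd : ∀ t, HasDerivAt Θ (g t) t := fun t =>
    (hg.continuous.integral_hasStrictDerivAt T t).hasDerivAt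
  have hΘs : ContDiff ℝ (⊤ : ℕ∞) Θ := by
    rw [contDiff_infty_iff_deriv]
    exact ⟨fun t => (hd t).differentiableAt, by rwa [funext fun t => (hd t).deriv]⟩
  have hΘ0 : ∀ t, b < t → Θ t = 0 := fun t ht => by
    rw [hΘ]
    simp only
    rw [intervalIntegral.integral_congr (g := fun _ => (0 : ℝ)), intervalIntegral.integral_zero]
    intro s hs'
    apply hg0
    exact (lt_min hbT ht).trans_le hs'.1
  -- The primitive is constant at large negative times; this bump, equal to one on `[-T, T]`,
  -- restores compact support without changing it on `(0, T)`.
  let κ : ContDiffBump (0 : ℝ) := ⟨T, T + 1, hT, by linarith⟩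
  refine ⟨fun t => κ t * Θ t, κ.contDiff.mul hΘs, κ.hasCompactSupport.mul_right, ?_, ?_⟩
  · have : tsupport (fun t => κ t * Θ t) ⊆ Iic b := by
      refine closure_minimal (fun t ht => ?_) isClosed_Iic
      by_contra hlt
      exact ht (by simp [hΘ0 t (not_le.1 hlt)])
    exact this.trans (Iic_subset_Iio.2 hbT)
  · intro t ht
    refine (hd t).congr_of_eventuallyEq ?_
    filter_upwards [isOpen_Ioo.mem_nhds ht] with s hs'
    have : κ s = 1 := κ.one_of_mem_closedBall (by
      rw [mem_closedBall_zero_iff, Real.norm_eq_abs, abs_of_pos hs'.1]; exact hs'.2.le)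
    rw [this, one_mul]

lemma integrableOn_Ioo_of_continuousOn {T C : ℝ} {Y : ℝ → ℝ} (hY : ContinuousOn Y (Ico 0 T))
    (hYb : ∀ t ∈ Ico 0 T, |Y t| ≤ C) : IntegrableOn Y (Ioo 0 T) := by
  refine IntegrableOn.of_bound (by simp)
    ((hY.mono Ioo_subset_Ico_self).aestronglyMeasurable measurableSet_Ioo) C ?_
  exact (ae_restrict_iff' measurableSet_Ioo).2
    (Eventually.of_forall fun t ht => hYb t (Ioo_subset_Ico_self ht))

/-- A weak formulation in time, including the initial time, integrates to the integral equation. -/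
lemma eq_integral_of_weak {T C : ℝ} (hT : 0 < T) {Y G : ℝ → ℝ} (hY : ContinuousOn Y (Ico 0 T))
    (hG : ContinuousOn G (Ico 0 T)) (hYb : ∀ t ∈ Ico 0 T, |Y t| ≤ C)
    (hGb : ∀ t ∈ Ico 0 T, |G t| ≤ C)
    (h : ∀ θ : ℝ → ℝ, ContDiff ℝ (⊤ : ℕ∞) θ → HasCompactSupport θ → tsupport θ ⊆ Iio T →
      -∫ t in Ioo 0 T, deriv θ t * Y t = ∫ t in Ioo 0 T, θ t * G t) :
    ∀ t ∈ Ico 0 T, Y t = ∫ s in (0 : ℝ)..t, G s := by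
  have hGi := integrableOn_Ioo_of_continuousOn hG hGb
  have hYi := integrableOn_Ioo_of_continuousOn hY hYb
  have hGii : IntervalIntegrable G volume 0 T := by
    rwa [intervalIntegrable_iff_integrableOn_Ioo_of_le hT.le]
  set H : ℝ → ℝ := fun t => ∫ s in (0 : ℝ)..t, G s with hH
  have hHc : ContinuousOn H (Icc 0 T) := by
    have := intervalIntegral.continuousOn_primitive_interval' hGii (a := 0) (by simp)
    rwa [uIcc_of_le hT.le] at this
  have hHd : ∀ t ∈ Ioo 0 T, HasDerivAt H (G t) t := fun t ht => by
    have hGc : ContinuousAt G t := (hG t (Ioo_subset_Ico_self ht)).continuousAt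
      (Ico_mem_nhds ht.1 ht.2)
    refine intervalIntegral.integral_hasDerivAt_right
      (hGii.mono_set (by rw [uIcc_of_le ht.1.le, uIcc_of_le hT.le]; exact Icc_subset_Icc_right ht.2.le))
      ?_ hGc
    exact (hG.mono Ioo_subset_Ico_self).stronglyMeasurableAtFilter isOpen_Ioo t ht
  have hZc : ContinuousOn (fun t => Y t - H t) (Ico 0 T) := hY.sub (hHc.mono Ico_subset_Icc_self)
  have hzero : ∀ᵐ t, t ∈ Ioo 0 T → Y t - H t = 0 := by
    refine isOpen_Ioo.ae_eq_zero_of_integral_contDiff_smul_eq_zero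
      ((hZc.mono Ioo_subset_Ico_self).locallyIntegrableOn measurableSet_Ioo) fun g hg hgc hgs => ?_
    obtain ⟨θ, h1, h2, h3, h4⟩ := exists_primitive_test_function hT hg hgc hgs
    have hθT : θ T = 0 := by
      by_contra hne
      exact lt_irrefl T (h3 (subset_tsupport θ hne))
    have hgb : ∃ K, ∀ t, ‖g t‖ ≤ K := hg.continuous.bounded_above_of_compact_support hgc
    obtain ⟨K, hK⟩ := hgb
    obtain ⟨K', hK'⟩ := h1.continuous.bounded_above_of_compact_support h2
    have i1 : IntegrableOn (fun t => g t * Y t) (Ioo 0 T) :=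
      hYi.bdd_mul hg.continuous.aestronglyMeasurable (Eventually.of_forall hK)
    have i2 : IntegrableOn (fun t => g t * H t) (Ioo 0 T) :=
      (((hg.continuous.continuousOn.mul hHc).integrableOn_compact isCompact_Icc).mono_set
        Ioo_subset_Icc_self)
    have i3 : IntegrableOn (fun t => θ t * G t) (Ioo 0 T) :=
      hGi.bdd_mul h1.continuous.aestronglyMeasurable (Eventually.of_forall hK')
    -- Both boundary terms vanish: `θ T = 0` at the final time and `H 0 = 0` at the initial time.
    -- Thus `θ 0` plays no role here, and the initial value of `Y` is forced to be zero.
    have hparts : ∫ t in Ioo 0 T, (g t * H t + θ t * G t) = 0 := by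
      have := intervalIntegral.integral_eq_sub_of_hasDerivAt_of_le hT.le
        (f := fun t => θ t * H t) (f' := fun t => g t * H t + θ t * G t)
        (h1.continuous.continuousOn.mul hHc) (fun t ht => (h4 t ht).mul (hHd t ht))
        (by rw [intervalIntegrable_iff_integrableOn_Ioo_of_le hT.le]; exact i2.add i3)
      rw [intervalIntegral.integral_of_le hT.le, integral_Ioc_eq_integral_Ioo] at this
      rw [this, hθT]
      simp [hH]
    have hw := h θ h1 h2 h3
    have hcongr : ∫ t in Ioo 0 T, deriv θ t * Y t = ∫ t in Ioo 0 T, g t * Y t :=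
      setIntegral_congr_fun measurableSet_Ioo fun t ht => by simp only [(h4 t ht).deriv]
    rw [hcongr] at hw
    rw [integral_add i2 i3] at hparts
    rw [← setIntegral_eq_integral_of_forall_compl_eq_zero (s := Ioo 0 T)]
    · simp only [smul_eq_mul, mul_sub]
      rw [integral_sub i1 i2]
      linarith
    · intro t ht
      have : g t = 0 := by
        by_contra hne
        exact ht (hgs (subset_tsupport g hne))
      simp [this]
  intro t ht
  have := le_of_ae_le_of_continuousOn hZc.abs (C := 0)
    ((ae_restrict_iff' measurableSet_Ioo).2 (hzero.mono fun s hs hs' => by simp [hs hs'])) t ht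
  have := abs_nonpos_iff.1 this
  linarith

/-! ### Bounds and continuity at every time. -/

section UniquenessClass

variable {T : ℝ} {ρ : ℝ → Space d → ℝ}

lemma InUniquenessClass.integrable (hρ : InUniquenessClass T ρ) {t : ℝ} (ht : t ∈ Ico 0 T) :
    Integrable (ρ t) := memLp_one_iff_integrable.1 (hρ.mem_L1 t ht)

/-- The `L¹` norm is bounded at every time. -/
lemma InUniquenessClass.exists_integral_abs_le (hρ : InUniquenessClass T ρ) :
    ∃ C : ℝ, 0 ≤ C ∧ ∀ t ∈ Ico 0 T, ∫ x, |ρ t x| ≤ C := by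
  obtain ⟨C, hC⟩ := hρ.bounded_L1
  refine ⟨C, C.2, fun t ht => ?_⟩
  obtain ⟨g, hg, hgt⟩ := (hρ.integrable ht).1
  -- The sign of `ρ t` at the one fixed time `t` is frozen as a bounded test function. Its pairing
  -- with `ρ s` is continuous in `s` and at most `C` for almost every `s`, hence also at `s = t`,
  -- where it equals the `L¹` norm.
  set ψ : Space d → ℝ := fun x => if 0 ≤ g x then 1 else -1 with hψ
  have hψm : Measurable ψ :=
    Measurable.ite (measurableSet_le measurable_const hg.measurable) measurable_const
      measurable_const
  have hψ1 : ∀ x, |ψ x| = 1 := fun x => by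
    simp only [hψ]; split_ifs <;> simp
  have hψL : MemLp ψ ∞ volume :=
    memLp_top_of_bound hψm.aestronglyMeasurable 1 (Eventually.of_forall fun x => (hψ1 x).le)
  have h1 : ∀ᵐ s ∂(volume.restrict (Ioo 0 T)), ∫ x, ρ s x * ψ x ≤ C := by
    filter_upwards [hC, ae_restrict_mem measurableSet_Ioo] with s hs hsT
    have hi := hρ.integrable (Ioo_subset_Ico_self hsT)
    have h2 : ∫ x, |ρ s x| ≤ C := by
      have := ENNReal.toReal_mono (by simp) hs
      rw [eLpNorm_one_eq_lintegral_enorm, ← integral_norm_eq_lintegral_enorm hi.1] at this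
      simpa using this
    refine le_trans ?_ h2
    refine (le_abs_self _).trans ?_
    rw [← Real.norm_eq_abs]
    refine norm_integral_le_of_norm_le hi.abs (Eventually.of_forall fun x => ?_)
    rw [Real.norm_eq_abs, abs_mul, hψ1, mul_one]
  have h3 := le_of_ae_le_of_continuousOn (hρ.weakly_continuous ψ hψL) h1 t ht
  refine le_trans (le_of_eq ?_) h3
  refine integral_congr_ae ?_
  filter_upwards [hgt] with x hx
  simp only [hψ, hx]
  split_ifs with h0
  · rw [abs_of_nonneg h0, mul_one]
  · rw [abs_of_neg (not_le.1 h0), mul_neg_one]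

lemma InUniquenessClass.continuousOn_integral_complex (hρ : InUniquenessClass T ρ)
    {β : Space d → ℂ} (hβ : Continuous β) {L : ℝ} (hL : ∀ x, ‖β x‖ ≤ L) :
    ContinuousOn (fun t => ∫ x, (ρ t x : ℂ) * β x) (Ico 0 T) := by
  have hre : MemLp (fun x => (β x).re) ∞ volume :=
    memLp_top_of_bound (Continuous.aestronglyMeasurable (by fun_prop)) L
      (Eventually.of_forall fun x => (Complex.abs_re_le_norm _).trans (hL x))
  have him : MemLp (fun x => (β x).im) ∞ volume :=
    memLp_top_of_bound (Continuous.aestronglyMeasurable (by fun_prop)) L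
      (Eventually.of_forall fun x => (Complex.abs_im_le_norm _).trans (hL x))
  have h1 := hρ.weakly_continuous _ hre
  have h2 := hρ.weakly_continuous _ him
  have h3 : ContinuousOn (fun t => ((∫ x, ρ t x * (β x).re : ℝ) : ℂ) +
      ((∫ x, ρ t x * (β x).im : ℝ) : ℂ) * Complex.I) (Ico 0 T) :=
    (Complex.continuous_ofReal.comp_continuousOn h1).add
      ((Complex.continuous_ofReal.comp_continuousOn h2).mul continuousOn_const)
  refine h3.congr fun t ht => ?_
  have hi : Integrable (fun x => (ρ t x : ℂ) * β x) :=
    (hρ.integrable ht).ofReal.mul_bdd (c := L) hβ.aestronglyMeasurable (Eventually.of_forall hL)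
  rw [← integral_re_add_im hi]
  simp

end UniquenessClass

/-! ### The nonlinear term in frequency variables. -/

/-- The nonlinear term of the weak formulation, tested against the vector field `b`. -/
def driftPairing (δ : ℝ) (ω u : Space d → ℝ) (b : Space d → Space d) : ℝ :=
  ∫ x, u x * inner ℝ (gradient (potential δ ω u) x) (b x)

/-- The operator bound of the map from densities to potential gradients. -/
def driftConst (δ : ℝ) (ω : Space d → ℝ) : ℝ := ∫ η, ‖η‖ * ‖driftSymbol δ ω η‖

lemma continuous_driftSymbol (δ : ℝ) {ω : Space d → ℝ} (hω : IsShortRangeKernel ω) :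
    Continuous (driftSymbol δ ω) := by
  have := continuous_realFourier hω.integrable
  unfold driftSymbol
  fun_prop

lemma integrable_norm_mul_driftSymbol (δ : ℝ) {ω : Space d → ℝ} (hω : IsShortRangeKernel ω) :
    Integrable (fun η => ‖η‖ * ‖driftSymbol δ ω η‖) := by
  refine ((hω.integrable_norm_pow_mul (n := 3) (by norm_num)).const_mul
    (8 * Real.pi ^ 3 * |δ|)).congr (Eventually.of_forall fun η => ?_)
  have h4 : ‖((4 * Real.pi ^ 2 * ‖η‖ ^ 2 : ℝ) : ℂ)‖ = 4 * Real.pi ^ 2 * ‖η‖ ^ 2 := by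
    rw [Complex.norm_real, Real.norm_of_nonneg (by positivity)]
  simp only [driftSymbol]
  rw [norm_mul, norm_mul, norm_mul (δ : ℂ), h4]
  simp only [norm_mul, Complex.norm_real, Complex.norm_I, Complex.norm_ofNat,
    Real.norm_eq_abs, abs_of_pos Real.pi_pos]
  ring

lemma norm_inner_mul_driftSymbol_mul_le (δ : ℝ) (ω : Space d → ℝ) {v : Space d} {L C : ℝ}
    (hv : ‖v‖ ≤ L) {z : ℂ} (hz : ‖z‖ ≤ C) (η : Space d) :
    ‖((inner ℝ v η : ℝ) : ℂ) * driftSymbol δ ω η * z‖ ≤ L * C * (‖η‖ * ‖driftSymbol δ ω η‖) := by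
  have h1 : |inner ℝ v η| ≤ L * ‖η‖ := (abs_real_inner_le_norm v η).trans (by gcongr)
  have hC := (norm_nonneg _).trans hz
  have hL := (norm_nonneg _).trans hv
  rw [norm_mul, norm_mul, Complex.norm_real, Real.norm_eq_abs]
  calc |inner ℝ v η| * ‖driftSymbol δ ω η‖ * ‖z‖
      ≤ (L * ‖η‖) * ‖driftSymbol δ ω η‖ * C := by gcongr
    _ = _ := by ring

lemma abs_inner_gradient_potential_le (δ : ℝ) {ω u : Space d → ℝ} (hω : IsShortRangeKernel ω)
    (hu : Integrable u) {C : ℝ} (hC : ∫ x, |u x| ≤ C) {v : Space d} {L : ℝ} (hv : ‖v‖ ≤ L)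
    (x : Space d) :
    |inner ℝ (gradient (potential δ ω u) x) v| ≤ driftConst δ ω * C * L := by
  rw [inner_gradient_potential δ hω hu]
  refine (Complex.abs_re_le_norm _).trans ?_
  refine (norm_integral_le_of_norm_le
    ((integrable_norm_mul_driftSymbol δ hω).const_mul (L * C))
    (Eventually.of_forall fun η => ?_)).trans_eq ?_
  · rw [Circle.norm_smul]
    exact norm_inner_mul_driftSymbol_mul_le δ ω hv ((norm_realFourier_le u η).trans hC) η
  · rw [integral_const_mul, driftConst]; ring

/-- The frequency-side integrand of the nonlinear term. -/
def driftIntegrand (δ : ℝ) (ω u : Space d → ℝ) (b : Space d → Space d) (η : Space d) : ℂ :=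
  driftSymbol δ ω η * realFourier u η *
    ∫ x, (u x : ℂ) * ((inner ℝ (b x) η : ℝ) * (Real.fourierChar (inner ℝ η x) : ℂ))

lemma integrable_drift_prod (δ : ℝ) {ω u : Space d → ℝ} (hω : IsShortRangeKernel ω)
    (hu : Integrable u) {b : Space d → Space d} (hb : Continuous b) {L : ℝ} (hL : ∀ x, ‖b x‖ ≤ L) :
    Integrable (fun p : Space d × Space d => (u p.1 : ℂ) * ((Real.fourierChar (inner ℝ p.2 p.1) : ℂ) *
      ((inner ℝ (b p.1) p.2 : ℝ) * driftSymbol δ ω p.2 * realFourier u p.2)))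
      (volume.prod volume) := by
  have hk := continuous_driftSymbol δ hω
  have hc := continuous_realFourier hu
  refine (hu.norm.mul_prod ((integrable_norm_mul_driftSymbol δ hω).const_mul
    (L * ∫ x, |u x|))).mono' ?_ (Eventually.of_forall fun p => ?_)
  · refine hu.ofReal.1.comp_fst.mul (Continuous.aestronglyMeasurable ?_)
    fun_prop
  · rw [norm_mul, norm_mul, Circle.norm_coe, one_mul, Complex.norm_real]
    gcongr
    exact norm_inner_mul_driftSymbol_mul_le δ ω (hL p.1) (norm_realFourier_le u p.2) p.2

lemma driftIntegrand_eq (δ : ℝ) (ω u : Space d → ℝ) (b : Space d → Space d) (η : Space d) :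
    driftIntegrand δ ω u b η = ∫ x, (u x : ℂ) * ((Real.fourierChar (inner ℝ η x) : ℂ) *
      ((inner ℝ (b x) η : ℝ) * driftSymbol δ ω η * realFourier u η)) := by
  rw [driftIntegrand, ← integral_const_mul]
  congr with x
  ring

lemma integrable_driftIntegrand (δ : ℝ) {ω u : Space d → ℝ} (hω : IsShortRangeKernel ω)
    (hu : Integrable u) {b : Space d → Space d} (hb : Continuous b) {L : ℝ} (hL : ∀ x, ‖b x‖ ≤ L) :
    Integrable (driftIntegrand δ ω u b) := by
  rw [funext (driftIntegrand_eq δ ω u b)]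
  exact (integrable_drift_prod δ hω hu hb hL).integral_prod_right

/-- Fubini's theorem: the gradient of the potential is an absolutely convergent integral in `η`, and
integrating in `x` first leaves only linear functionals of `u` at each fixed `η`. -/
lemma driftPairing_eq_re_integral (δ : ℝ) {ω u : Space d → ℝ} (hω : IsShortRangeKernel ω)
    (hu : Integrable u) {b : Space d → Space d} (hb : Continuous b) {L : ℝ} (hL : ∀ x, ‖b x‖ ≤ L) :
    driftPairing δ ω u b = (∫ η, driftIntegrand δ ω u b η).re := by
  have hprod := integrable_drift_prod δ hω hu hb hL
  rw [funext (driftIntegrand_eq δ ω u b), ← integral_integral_swap hprod, driftPairing]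
  have h1 := hprod.integral_prod_left
  have h2 : (∫ x, ∫ η, (u x : ℂ) * ((Real.fourierChar (inner ℝ η x) : ℂ) *
      ((inner ℝ (b x) η : ℝ) * driftSymbol δ ω η * realFourier u η))).re =
      ∫ x, (∫ η, (u x : ℂ) * ((Real.fourierChar (inner ℝ η x) : ℂ) *
      ((inner ℝ (b x) η : ℝ) * driftSymbol δ ω η * realFourier u η))).re :=
    (integral_re h1).symm
  rw [h2]
  congr with x
  rw [integral_const_mul, Complex.re_ofReal_mul, inner_gradient_potential δ hω hu]
  rfl

lemma norm_integral_mul_le {u : Space d → ℝ} (hu : Integrable u) {β : Space d → ℂ} {L C : ℝ}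
    (hL0 : 0 ≤ L) (hL : ∀ x, ‖β x‖ ≤ L) (hC : ∫ x, |u x| ≤ C) :
    ‖∫ x, (u x : ℂ) * β x‖ ≤ C * L := by
  refine (norm_integral_le_of_norm_le (hu.abs.mul_const L) (Eventually.of_forall fun x => ?_)).trans ?_
  · rw [norm_mul, Complex.norm_real, Real.norm_eq_abs]
    gcongr
    exact hL x
  · rw [integral_mul_const]
    gcongr

lemma norm_driftIntegrand_le (δ : ℝ) {ω u : Space d → ℝ} (hu : Integrable u)
    {b : Space d → Space d} {L C : ℝ} (hL : ∀ x, ‖b x‖ ≤ L) (hC : ∫ x, |u x| ≤ C) (η : Space d) :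
    ‖driftIntegrand δ ω u b η‖ ≤ C * C * L * (‖η‖ * ‖driftSymbol δ ω η‖) := by
  have hL0 : 0 ≤ L := (norm_nonneg _).trans (hL 0)
  have hC0 : 0 ≤ C := (integral_nonneg fun x => abs_nonneg (u x)).trans hC
  have h1 : ‖∫ x, (u x : ℂ) * ((inner ℝ (b x) η : ℝ) * (Real.fourierChar (inner ℝ η x) : ℂ))‖
      ≤ C * (L * ‖η‖) := by
    refine norm_integral_mul_le hu (by positivity) (fun x => ?_) hC
    rw [norm_mul, Circle.norm_coe, mul_one, Complex.norm_real, Real.norm_eq_abs]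
    refine (abs_real_inner_le_norm _ _).trans ?_
    gcongr
    exact hL x
  rw [driftIntegrand, norm_mul, norm_mul]
  calc _ ≤ ‖driftSymbol δ ω η‖ * C * (C * (L * ‖η‖)) := by
        gcongr
        exact (norm_realFourier_le u η).trans hC
    _ = _ := by ring

lemma abs_driftPairing_le (δ : ℝ) {ω u : Space d → ℝ} (hω : IsShortRangeKernel ω)
    (hu : Integrable u) {b : Space d → Space d} (hb : Continuous b) {L C : ℝ}
    (hL : ∀ x, ‖b x‖ ≤ L) (hC : ∫ x, |u x| ≤ C) :
    |driftPairing δ ω u b| ≤ C * C * L * driftConst δ ω := by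
  rw [driftPairing_eq_re_integral δ hω hu hb hL, driftConst, ← integral_const_mul]
  refine (Complex.abs_re_le_norm _).trans ?_
  exact norm_integral_le_of_norm_le ((integrable_norm_mul_driftSymbol δ hω).const_mul _)
    (Eventually.of_forall fun η => norm_driftIntegrand_le δ hu hL hC η)

lemma realFourier_eq_integral (u : Space d → ℝ) (ξ : Space d) :
    realFourier u ξ = ∫ x, (u x : ℂ) * (Real.fourierChar (-inner ℝ x ξ) : ℂ) := by
  rw [realFourier, Real.fourier_eq]
  congr with x
  rw [Circle.smul_def, smul_eq_mul, mul_comm]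

lemma InUniquenessClass.continuousOn_realFourier {T : ℝ} {ρ : ℝ → Space d → ℝ}
    (hρ : InUniquenessClass T ρ) (ξ : Space d) :
    ContinuousOn (fun t => realFourier (ρ t) ξ) (Ico 0 T) := by
  simp only [realFourier_eq_integral]
  exact hρ.continuousOn_integral_complex (L := 1) (by fun_prop) fun x => (Circle.norm_coe _).le

/-- Weak convergence does not pass to products in general. Here, for each `η`, the integrand is a
product of two scalar pairings of `ρ t` with bounded continuous functions, each continuous in `t`,
and `driftConst` provides the dominating function. -/
lemma InUniquenessClass.continuousOn_driftPairing {T : ℝ} {ρ : ℝ → Space d → ℝ}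
    (hρ : InUniquenessClass T ρ) (δ : ℝ) {ω : Space d → ℝ} (hω : IsShortRangeKernel ω)
    {b : Space d → Space d} (hb : Continuous b) {L : ℝ} (hL : ∀ x, ‖b x‖ ≤ L) :
    ContinuousOn (fun t => driftPairing δ ω (ρ t) b) (Ico 0 T) := by
  obtain ⟨C, -, hC⟩ := hρ.exists_integral_abs_le
  have h1 : ContinuousOn (fun t => ∫ η, driftIntegrand δ ω (ρ t) b η) (Ico 0 T) := by
    refine continuousOn_of_dominated
      (bound := fun η => C * C * L * (‖η‖ * ‖driftSymbol δ ω η‖))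
      (fun t ht => (integrable_driftIntegrand δ hω (hρ.integrable ht) hb hL).1)
      (fun t ht => Eventually.of_forall fun η =>
        norm_driftIntegrand_le δ (hρ.integrable ht) hL (hC t ht) η)
      ((integrable_norm_mul_driftSymbol δ hω).const_mul _) (Eventually.of_forall fun η => ?_)
    unfold driftIntegrand
    refine (continuousOn_const.mul (hρ.continuousOn_realFourier η)).mul
      (hρ.continuousOn_integral_complex (L := L * ‖η‖) (by fun_prop) fun x => ?_)
    rw [norm_mul, Circle.norm_coe, mul_one, Complex.norm_real, Real.norm_eq_abs]
    refine (abs_real_inner_le_norm _ _).trans ?_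
    gcongr
    exact hL x
  refine (Complex.continuous_re.comp_continuousOn h1).congr fun t ht => ?_
  exact driftPairing_eq_re_integral δ hω (hρ.integrable ht) hb hL

/-! ### Plane waves and the Lipschitz estimate. -/

/-- The plane wave with frequency `ξ` and phase `θ`. -/
def planeWave (ξ : Space d) (θ : ℝ) (x : Space d) : ℝ := Real.cos (2 * Real.pi * inner ℝ x ξ + θ)

lemma abs_planeWave_le_one (ξ : Space d) (θ : ℝ) (x : Space d) : |planeWave ξ θ x| ≤ 1 :=
  Real.abs_cos_le_one _

lemma continuous_planeWave (ξ : Space d) (θ : ℝ) : Continuous (planeWave ξ θ) := by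
  unfold planeWave; fun_prop

lemma planeWave_mul_fourierChar (ξ η : Space d) (θ : ℝ) (x : Space d) :
    (planeWave ξ θ x : ℂ) * (Real.fourierChar (inner ℝ η x) : ℂ) =
      Complex.exp (θ * Complex.I) / 2 * (Real.fourierChar (-inner ℝ x (-η - ξ)) : ℂ) +
      Complex.exp (-θ * Complex.I) / 2 * (Real.fourierChar (-inner ℝ x (ξ - η)) : ℂ) := by
  rw [planeWave, Complex.ofReal_cos, Complex.cos, Real.fourierChar_apply, Real.fourierChar_apply,
    Real.fourierChar_apply, div_mul_eq_mul_div, add_mul, ← Complex.exp_add, ← Complex.exp_add,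
    div_mul_eq_mul_div, div_mul_eq_mul_div, ← Complex.exp_add, ← Complex.exp_add, add_div,
    real_inner_comm x η, inner_sub_right, inner_sub_right, inner_neg_right]
  push_cast
  congr 3 <;> ring

/-- Multiplying by a plane wave only shifts frequencies, so this factor of the nonlinear term is
again controlled by the supremum of `û`, and the estimate closes in that norm. -/
lemma integral_planeWave_mul_fourierChar {u : Space d → ℝ} (hu : Integrable u) (ξ η : Space d)
    (θ : ℝ) :
    ∫ x, (u x : ℂ) * ((planeWave ξ θ x : ℂ) * (Real.fourierChar (inner ℝ η x) : ℂ)) =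
      Complex.exp (θ * Complex.I) / 2 * realFourier u (-η - ξ) +
      Complex.exp (-θ * Complex.I) / 2 * realFourier u (ξ - η) := by
  have hi : ∀ ζ : Space d, Integrable (fun x => (u x : ℂ) * (Real.fourierChar (-inner ℝ x ζ) : ℂ)) :=
    fun ζ => hu.ofReal.mul_bdd (c := 1) (Continuous.aestronglyMeasurable (by fun_prop))
      (Eventually.of_forall fun x => (Circle.norm_coe _).le)
  rw [realFourier_eq_integral, realFourier_eq_integral, ← integral_const_mul, ← integral_const_mul,
    ← integral_add ((hi _).const_mul _) ((hi _).const_mul _)]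
  congr with x
  rw [planeWave_mul_fourierChar]
  ring

lemma driftIntegrand_planeWave_smul (δ : ℝ) (ω : Space d → ℝ) (u : Space d → ℝ)
    (ξ v : Space d) (θ : ℝ) (η : Space d) :
    driftIntegrand δ ω u (fun x => planeWave ξ θ x • v) η =
      ((inner ℝ v η : ℝ) : ℂ) * driftSymbol δ ω η * (realFourier u η *
        ∫ x, (u x : ℂ) * ((planeWave ξ θ x : ℂ) * (Real.fourierChar (inner ℝ η x) : ℂ))) := by
  have : ∫ x, (u x : ℂ) * ((inner ℝ (planeWave ξ θ x • v) η : ℝ) *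
      (Real.fourierChar (inner ℝ η x) : ℂ)) = ((inner ℝ v η : ℝ) : ℂ) *
      ∫ x, (u x : ℂ) * ((planeWave ξ θ x : ℂ) * (Real.fourierChar (inner ℝ η x) : ℂ)) := by
    rw [← integral_const_mul]
    congr with x
    rw [real_inner_smul_left]
    push_cast
    ring
  rw [driftIntegrand, this]
  ring

/-- Lipschitz estimate for the nonlinear term in the supremum norm of the Fourier transform. -/
lemma abs_driftPairing_sub_le (δ : ℝ) {ω u₁ u₂ : Space d → ℝ} (hω : IsShortRangeKernel ω)
    (h₁ : Integrable u₁) (h₂ : Integrable u₂) {C B : ℝ} (hC₁ : ∫ x, |u₁ x| ≤ C)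
    (hC₂ : ∫ x, |u₂ x| ≤ C) (hB : ∀ η, ‖realFourier u₁ η - realFourier u₂ η‖ ≤ B)
    (ξ v : Space d) (θ : ℝ) :
    |driftPairing δ ω u₁ (fun x => planeWave ξ θ x • v) -
      driftPairing δ ω u₂ (fun x => planeWave ξ θ x • v)| ≤
      2 * C * driftConst δ ω * ‖v‖ * B := by
  have hC0 : 0 ≤ C := (integral_nonneg fun x => abs_nonneg (u₁ x)).trans hC₁
  have hB0 : 0 ≤ B := (norm_nonneg _).trans (hB 0)
  set b : Space d → Space d := fun x => planeWave ξ θ x • v with hbdef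
  have hb : Continuous b := (continuous_planeWave ξ θ).smul continuous_const
  have hL : ∀ x, ‖b x‖ ≤ ‖v‖ := fun x => by
    rw [hbdef]
    simp only
    rw [norm_smul, Real.norm_eq_abs]
    exact mul_le_of_le_one_left (norm_nonneg _) (abs_planeWave_le_one ξ θ x)
  rw [driftPairing_eq_re_integral δ hω h₁ hb hL, driftPairing_eq_re_integral δ hω h₂ hb hL,
    ← Complex.sub_re, ← integral_sub (integrable_driftIntegrand δ hω h₁ hb hL)
      (integrable_driftIntegrand δ hω h₂ hb hL)]
  refine (Complex.abs_re_le_norm _).trans ?_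
  refine (norm_integral_le_of_norm_le
    ((integrable_norm_mul_driftSymbol δ hω).const_mul (‖v‖ * (2 * C * B)))
    (Eventually.of_forall fun η => ?_)).trans_eq ?_
  · rw [hbdef, driftIntegrand_planeWave_smul, driftIntegrand_planeWave_smul, ← mul_sub]
    refine norm_inner_mul_driftSymbol_mul_le δ ω le_rfl ?_ η
    set p : (Space d → ℝ) → ℂ := fun u => ∫ x, (u x : ℂ) *
      ((planeWave ξ θ x : ℂ) * (Real.fourierChar (inner ℝ η x) : ℂ)) with hp
    have hp1 : ‖p u₁‖ ≤ C := by
      refine (norm_integral_mul_le h₁ zero_le_one (fun x => ?_) hC₁).trans_eq (mul_one C)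
      rw [norm_mul, Circle.norm_coe, mul_one, Complex.norm_real]
      exact abs_planeWave_le_one ξ θ x
    have hp2 : ‖p u₁ - p u₂‖ ≤ B := by
      simp only [hp]
      rw [integral_planeWave_mul_fourierChar h₁, integral_planeWave_mul_fourierChar h₂,
        add_sub_add_comm, ← mul_sub, ← mul_sub]
      refine (norm_add_le _ _).trans ?_
      have e1 : ‖Complex.exp (θ * Complex.I)‖ = 1 := Complex.norm_exp_ofReal_mul_I θ
      have e2 : ‖Complex.exp (-θ * Complex.I)‖ = 1 := by
        simpa using Complex.norm_exp_ofReal_mul_I (-θ)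
      rw [norm_mul, norm_mul, norm_div, norm_div, e1, e2, Complex.norm_ofNat]
      have := hB (-η - ξ)
      have := hB (ξ - η)
      linarith
    -- The quadratic expression is split so that each summand has one difference, at most `B`, and
    -- one undifferenced factor, at most `C`; this is the source of the constant `2 * C`.
    have e : realFourier u₁ η * p u₁ - realFourier u₂ η * p u₂ =
        (realFourier u₁ η - realFourier u₂ η) * p u₁ + realFourier u₂ η * (p u₁ - p u₂) := by ring
    rw [e]
    refine (norm_add_le _ _).trans ?_
    rw [norm_mul, norm_mul]
    calc _ ≤ B * C + C * B := by
          gcongr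
          · exact hB η
          · exact (norm_realFourier_le _ _).trans hC₂
      _ = _ := by ring
  · rw [integral_const_mul, driftConst]; ring

/-! ### Separated test functions and spatial cut-offs. -/

lemma isTestFunction_mul {T : ℝ} {θ : ℝ → ℝ} {ψ : Space d → ℝ} (h1 : ContDiff ℝ (⊤ : ℕ∞) θ)
    (h2 : HasCompactSupport θ) (h3 : tsupport θ ⊆ Iio T) (h4 : ContDiff ℝ (⊤ : ℕ∞) ψ)
    (h5 : HasCompactSupport ψ) : IsTestFunction T (fun p : ℝ × Space d => θ p.1 * ψ p.2) := by
  have hsub : tsupport (fun p : ℝ × Space d => θ p.1 * ψ p.2) ⊆ tsupport θ ×ˢ tsupport ψ := by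
    refine closure_minimal (fun p hp => ?_) ((isClosed_tsupport θ).prod (isClosed_tsupport ψ))
    exact ⟨subset_tsupport θ (left_ne_zero_of_mul hp), subset_tsupport ψ (right_ne_zero_of_mul hp)⟩
  refine ⟨(h1.comp contDiff_fst).mul (h4.comp contDiff_snd), ?_, fun p hp => ⟨h3 (hsub hp).1, trivial⟩⟩
  exact (h2.isCompact.prod h5.isCompact).of_isClosed_subset (isClosed_tsupport _) hsub

lemma gradient_const_mul (c : ℝ) {ψ : Space d → ℝ} (h : Differentiable ℝ ψ) (x : Space d) :
    gradient (fun y => c * ψ y) x = c • gradient ψ x := by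
  rw [gradient, gradient, fderiv_const_mul (h x), map_smul]

lemma IsDistributionalSolution.separated {T D δ : ℝ} {ω ρ0 : Space d → ℝ} {ρ : ℝ → Space d → ℝ}
    (hs : IsDistributionalSolution T D δ ω ρ0 ρ) {θ : ℝ → ℝ} {ψ : Space d → ℝ}
    (h1 : ContDiff ℝ (⊤ : ℕ∞) θ) (h2 : HasCompactSupport θ) (h3 : tsupport θ ⊆ Iio T)
    (h4 : ContDiff ℝ (⊤ : ℕ∞) ψ) (h5 : HasCompactSupport ψ) :
    (-∫ x, ρ0 x * (θ 0 * ψ x)) - ∫ t in Ioo 0 T, deriv θ t * ∫ x, ρ t x * ψ x =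
      D * (∫ t in Ioo 0 T, θ t * ∫ x, ρ t x * Laplacian.laplacian ψ x) -
        ∫ t in Ioo 0 T, θ t * driftPairing δ ω (ρ t) (gradient ψ) := by
  have h := hs _ (isTestFunction_mul h1 h2 h3 h4 h5)
  have e1 : ∀ t x, deriv (fun s => θ s * ψ x) t = deriv θ t * ψ x := fun t x =>
    deriv_mul_const (h1.differentiable (by simp) t) _
  have e2 : ∀ t x, Laplacian.laplacian (fun y => θ t * ψ y) x = θ t * Laplacian.laplacian ψ x :=
    fun t x => InnerProductSpace.laplacian_smul (θ t) (contDiff_infty.1 h4 2).contDiffAt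
  have e3 : ∀ t x, gradient (fun y => θ t * ψ y) x = θ t • gradient ψ x := fun t x =>
    gradient_const_mul _ (h4.differentiable (by simp)) x
  simp only [e1, e2, e3, real_inner_smul_right] at h
  have m : ∀ (t c : ℝ) (f : Space d → ℝ), ∫ x, ρ t x * (c * f x) = c * ∫ x, ρ t x * f x :=
    fun t c f => by
      rw [← integral_const_mul]
      congr with x
      ring
  simp only [m] at h
  exact h

lemma continuous_gradient {ψ : Space d → ℝ} (h : ContDiff ℝ (⊤ : ℕ∞) ψ) :
    Continuous (gradient ψ) :=
  (InnerProductSpace.toDual ℝ (Space d)).symm.continuous.comp (h.continuous_fderiv (by simp))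

lemma continuous_laplacian {ψ : Space d → ℝ} (h : ContDiff ℝ (⊤ : ℕ∞) ψ) :
    Continuous (Laplacian.laplacian ψ) := by
  rw [InnerProductSpace.laplacian_eq_iteratedFDeriv_orthonormalBasis ψ
    (EuclideanSpace.basisFun (Fin d) ℝ)]
  have : Continuous (iteratedFDeriv ℝ 2 ψ) := (contDiff_infty.1 h 2).continuous_iteratedFDeriv le_rfl
  refine continuous_finsetSum _ fun i _ => ?_
  exact (continuous_eval_const _).comp this

lemma norm_gradient_le {ψ : Space d → ℝ} {K : ℝ} {x : Space d}
    (h : ‖iteratedFDeriv ℝ 1 ψ x‖ ≤ K) : ‖gradient ψ x‖ ≤ K := by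
  rw [norm_iteratedFDeriv_one] at h
  rwa [gradient, LinearIsometryEquiv.norm_map]

lemma abs_laplacian_le {ψ : Space d → ℝ} {K : ℝ} {x : Space d}
    (h : ‖iteratedFDeriv ℝ 2 ψ x‖ ≤ K) : |Laplacian.laplacian ψ x| ≤ d * K := by
  rw [InnerProductSpace.laplacian_eq_iteratedFDeriv_orthonormalBasis ψ
    (EuclideanSpace.basisFun (Fin d) ℝ)]
  refine (Finset.abs_sum_le_sum_abs _ _).trans ?_
  refine (Finset.sum_le_card_nsmul _ _ K fun i _ => ?_).trans_eq (by simp)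
  refine ((iteratedFDeriv ℝ 2 ψ x).le_opNorm _).trans ?_
  simpa [Fin.prod_univ_two] using h

section Cutoff

/-- Dilated smooth cut-off functions. -/
def cutoff (d n : ℕ) (x : Space d) : ℝ :=
  (⟨1, 2, by norm_num, by norm_num⟩ : ContDiffBump (0 : Space d)) (((n : ℝ) + 1)⁻¹ • x)

lemma contDiff_cutoff (d n : ℕ) : ContDiff ℝ (⊤ : ℕ∞) (cutoff d n) :=
  (ContDiffBump.contDiff _).comp (contDiff_const_smul _)

lemma hasCompactSupport_cutoff (d n : ℕ) : HasCompactSupport (cutoff d n) :=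
  (ContDiffBump.hasCompactSupport _).comp_homeomorph
    (Homeomorph.smulOfNeZero ((n : ℝ) + 1)⁻¹ (by positivity))

/-- Equality on a neighbourhood, rather than at the point alone, makes gradients and Laplacians of
the cut-off test functions eventually coincide with the uncut ones. -/
lemma cutoff_eventually_eq_one (x : Space d) : ∀ᶠ n in atTop, ∀ᶠ y in 𝓝 x, cutoff d n y = 1 := by
  obtain ⟨N, hN⟩ := exists_nat_gt (‖x‖ + 1)
  filter_upwards [eventually_ge_atTop N] with n hn
  filter_upwards [Metric.ball_mem_nhds x one_pos] with y hy
  apply ContDiffBump.one_of_mem_closedBall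
  rw [mem_closedBall_zero_iff, norm_smul, norm_inv, Real.norm_of_nonneg (by positivity),
    inv_mul_le_iff₀ (by positivity), mul_one]
  have h1 : ‖y‖ ≤ ‖x‖ + 1 := by
    have := norm_sub_norm_le y x
    rw [mem_ball_iff_norm] at hy
    linarith
  have h2 : (N : ℝ) ≤ n := by exact_mod_cast hn
  linarith

lemma exists_norm_iteratedFDeriv_cutoff_le (d : ℕ) : ∃ K : ℝ, 0 ≤ K ∧ ∀ n : ℕ, ∀ i ≤ 2,
    ∀ x : Space d, ‖iteratedFDeriv ℝ i (cutoff d n) x‖ ≤ K := by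
  let χ : ContDiffBump (0 : Space d) := ⟨1, 2, by norm_num, by norm_num⟩
  have hb : ∀ i : ℕ, ∃ K, ∀ x, ‖iteratedFDeriv ℝ i χ x‖ ≤ K := fun i =>
    ((χ.contDiff (n := (⊤ : ℕ∞))).continuous_iteratedFDeriv (m := i)
      (by exact_mod_cast le_top)).bounded_above_of_compact_support (χ.hasCompactSupport.iteratedFDeriv i)
  choose K hK using hb
  have hK0 : ∀ i, 0 ≤ K i := fun i => (norm_nonneg _).trans (hK i 0)
  refine ⟨K 0 + K 1 + K 2, by linarith [hK0 0, hK0 1, hK0 2], fun n i hi x => ?_⟩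
  have h1 : iteratedFDeriv ℝ i (cutoff d n) x =
      (((n : ℝ) + 1)⁻¹) ^ i • iteratedFDeriv ℝ i χ (((n : ℝ) + 1)⁻¹ • x) :=
    congrFun (iteratedFDeriv_comp_const_smul _ χ.contDiff) x
  have h2 : ((n : ℝ) + 1)⁻¹ ≤ 1 := inv_le_one_of_one_le₀ (by
    have : (0 : ℝ) ≤ n := n.cast_nonneg
    linarith)
  -- Each derivative of the dilated bump brings a factor `1 / (n + 1) ≤ 1`, so the bounds of the
  -- undilated bump serve for all `n`.
  rw [h1, norm_smul, norm_pow, Real.norm_of_nonneg (by positivity)]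
  refine (mul_le_of_le_one_left (norm_nonneg _) (pow_le_one₀ (by positivity) h2)).trans
    ((hK i _).trans ?_)
  have := hK0 0
  have := hK0 1
  have := hK0 2
  interval_cases i <;> linarith

lemma exists_norm_iteratedFDeriv_cutoff_mul_le {ψ : Space d → ℝ} (hψ : ContDiff ℝ (⊤ : ℕ∞) ψ)
    {K : ℝ} (hK : ∀ i ≤ 2, ∀ x, ‖iteratedFDeriv ℝ i ψ x‖ ≤ K) : ∃ K' : ℝ, 0 ≤ K' ∧ ∀ n : ℕ,
      ∀ i ≤ 2, ∀ x : Space d, ‖iteratedFDeriv ℝ i (fun y => cutoff d n y * ψ y) x‖ ≤ K' := by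
  obtain ⟨L, hL0, hL⟩ := exists_norm_iteratedFDeriv_cutoff_le d
  have hK0 : 0 ≤ K := (norm_nonneg _).trans (hK 0 (by norm_num) 0)
  -- By Leibniz' rule the binomial coefficients sum to `2 ^ i ≤ 4` for `i ≤ 2`.
  refine ⟨4 * (L * K), by positivity, fun n i hi x => ?_⟩
  refine (norm_iteratedFDeriv_mul_le (contDiff_cutoff d n) hψ x (by exact_mod_cast le_top)).trans ?_
  calc _ ≤ ∑ j ∈ Finset.range (i + 1), (i.choose j : ℝ) * (L * K) := by
        refine Finset.sum_le_sum fun j hj => ?_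
        rw [mul_assoc]
        have := Finset.mem_range.1 hj
        gcongr
        · exact hL n j (by omega) x
        · exact hK _ (by omega) x
    _ = 2 ^ i * (L * K) := by
        rw [← Finset.sum_mul]
        congr 1
        exact_mod_cast Nat.sum_range_choose i
    _ ≤ 4 * (L * K) := by
        gcongr
        calc (2 : ℝ) ^ i ≤ 2 ^ 2 := pow_le_pow_right₀ (by norm_num) hi
          _ = 4 := by norm_num

end Cutoff

/-! ### The integrated equation for the difference of two solutions. -/

section WeakForm

variable {T D δ : ℝ} {ω ρ0 : Space d → ℝ} {ρ₁ ρ₂ : ℝ → Space d → ℝ}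

lemma InUniquenessClass.continuousOn_integral {ρ : ℝ → Space d → ℝ} (hρ : InUniquenessClass T ρ)
    {f : Space d → ℝ} (hf : Continuous f) {L : ℝ} (hL : ∀ x, |f x| ≤ L) :
    ContinuousOn (fun t => ∫ x, ρ t x * f x) (Ico 0 T) :=
  hρ.weakly_continuous f (memLp_top_of_bound hf.aestronglyMeasurable L (Eventually.of_forall hL))

lemma abs_integral_mul_le {u f : Space d → ℝ} (hu : Integrable u) {L C : ℝ}
    (hL : ∀ x, |f x| ≤ L) (hC : ∫ x, |u x| ≤ C) : |∫ x, u x * f x| ≤ C * L := by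
  have hL0 : 0 ≤ L := (abs_nonneg _).trans (hL 0)
  rw [← Real.norm_eq_abs]
  refine (norm_integral_le_of_norm_le (hu.abs.mul_const L) (Eventually.of_forall fun x => ?_)).trans ?_
  · rw [norm_mul, Real.norm_eq_abs]
    gcongr
    exact hL x
  · rw [integral_mul_const]
    gcongr

/-- The right-hand side of the weak formulation at a fixed time. -/
def weakRHS (D δ : ℝ) (ω u : Space d → ℝ) (ψ : Space d → ℝ) : ℝ :=
  D * (∫ x, u x * Laplacian.laplacian ψ x) - driftPairing δ ω u (gradient ψ)

lemma InUniquenessClass.continuousOn_weakRHS {ρ : ℝ → Space d → ℝ} (hρ : InUniquenessClass T ρ)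
    (D δ : ℝ) (hω : IsShortRangeKernel ω) {ψ : Space d → ℝ} (hψ : ContDiff ℝ (⊤ : ℕ∞) ψ)
    {K : ℝ} (hK : ∀ i ≤ 2, ∀ x, ‖iteratedFDeriv ℝ i ψ x‖ ≤ K) :
    ContinuousOn (fun t => weakRHS D δ ω (ρ t) ψ) (Ico 0 T) :=
  (continuousOn_const.mul (hρ.continuousOn_integral (continuous_laplacian hψ)
    fun x => abs_laplacian_le (hK 2 le_rfl x))).sub
    (hρ.continuousOn_driftPairing δ hω (continuous_gradient hψ)
      fun x => norm_gradient_le (hK 1 (by norm_num) x))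

lemma abs_weakRHS_le (D δ : ℝ) (hω : IsShortRangeKernel ω) {u ψ : Space d → ℝ} (hu : Integrable u)
    {C : ℝ} (hC : ∫ x, |u x| ≤ C) (hψ : ContDiff ℝ (⊤ : ℕ∞) ψ)
    {K : ℝ} (hK : ∀ i ≤ 2, ∀ x, ‖iteratedFDeriv ℝ i ψ x‖ ≤ K) :
    |weakRHS D δ ω u ψ| ≤ |D| * (C * (d * K)) + C * C * K * driftConst δ ω := by
  refine (abs_sub _ _).trans ?_
  rw [abs_mul]
  gcongr
  · exact abs_integral_mul_le hu (fun x => abs_laplacian_le (hK 2 le_rfl x)) hC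
  · exact abs_driftPairing_le δ hω hu (continuous_gradient hψ)
      (fun x => norm_gradient_le (hK 1 (by norm_num) x)) hC

lemma norm_iteratedFDeriv_zero_le {ψ : Space d → ℝ} {K : ℝ}
    (hK : ∀ i ≤ 2, ∀ x, ‖iteratedFDeriv ℝ i ψ x‖ ≤ K) (x : Space d) : |ψ x| ≤ K := by
  simpa using hK 0 (by norm_num) x

lemma IsDistributionalSolution.weak_in_time (hω : IsShortRangeKernel ω)
    {ρ : ℝ → Space d → ℝ} (hc : InUniquenessClass T ρ)
    (hs : IsDistributionalSolution T D δ ω ρ0 ρ) {ψ : Space d → ℝ}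
    (hψ : ContDiff ℝ (⊤ : ℕ∞) ψ) (hψc : HasCompactSupport ψ)
    {K : ℝ} (hK : ∀ i ≤ 2, ∀ x, ‖iteratedFDeriv ℝ i ψ x‖ ≤ K) {θ : ℝ → ℝ}
    (h1 : ContDiff ℝ (⊤ : ℕ∞) θ) (h2 : HasCompactSupport θ) (h3 : tsupport θ ⊆ Iio T) :
    (-∫ x, ρ0 x * (θ 0 * ψ x)) - ∫ t in Ioo 0 T, deriv θ t * ∫ x, ρ t x * ψ x =
      ∫ t in Ioo 0 T, θ t * weakRHS D δ ω (ρ t) ψ := by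
  obtain ⟨C, hC0, hC⟩ := hc.exists_integral_abs_le
  obtain ⟨B, hB⟩ := h1.continuous.bounded_above_of_compact_support h2
  have i1 : IntegrableOn (fun t => θ t * ∫ x, ρ t x * Laplacian.laplacian ψ x) (Ioo 0 T) := by
    refine (integrableOn_Ioo_of_continuousOn (C := C * (d * K))
      (hc.continuousOn_integral (continuous_laplacian hψ)
        fun x => abs_laplacian_le (hK 2 le_rfl x)) fun t ht => ?_).bdd_mul
      h1.continuous.aestronglyMeasurable (Eventually.of_forall hB)
    exact abs_integral_mul_le (hc.integrable ht) (fun x => abs_laplacian_le (hK 2 le_rfl x)) (hC t ht)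
  have i2 : IntegrableOn (fun t => θ t * driftPairing δ ω (ρ t) (gradient ψ)) (Ioo 0 T) := by
    refine (integrableOn_Ioo_of_continuousOn (C := C * C * K * driftConst δ ω)
      (hc.continuousOn_driftPairing δ hω (continuous_gradient hψ)
      fun x => norm_gradient_le (hK 1 (by norm_num) x)) fun t ht => ?_).bdd_mul
      h1.continuous.aestronglyMeasurable (Eventually.of_forall hB)
    exact abs_driftPairing_le δ hω (hc.integrable ht) (continuous_gradient hψ)
      (fun x => norm_gradient_le (hK 1 (by norm_num) x)) (hC t ht)
  rw [hs.separated h1 h2 h3 hψ hψc, ← integral_const_mul, ← integral_sub (i1.const_mul D) i2]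
  congr with t
  rw [weakRHS]
  ring

/-- The integrated equation for the difference of two solutions, compactly supported test function. -/
lemma integral_sub_eq_of_hasCompactSupport (hT : 0 < T) (hω : IsShortRangeKernel ω)
    (hc₁ : InUniquenessClass T ρ₁) (hc₂ : InUniquenessClass T ρ₂)
    (hs₁ : IsDistributionalSolution T D δ ω ρ0 ρ₁) (hs₂ : IsDistributionalSolution T D δ ω ρ0 ρ₂)
    {ψ : Space d → ℝ} (hψ : ContDiff ℝ (⊤ : ℕ∞) ψ) (hψc : HasCompactSupport ψ)
    {K : ℝ} (hK : ∀ i ≤ 2, ∀ x, ‖iteratedFDeriv ℝ i ψ x‖ ≤ K) :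
    ∀ t ∈ Ico 0 T, (∫ x, ρ₁ t x * ψ x) - (∫ x, ρ₂ t x * ψ x) =
      ∫ s in (0 : ℝ)..t, (weakRHS D δ ω (ρ₁ s) ψ - weakRHS D δ ω (ρ₂ s) ψ) := by
  obtain ⟨C₁, hC₁0, hC₁⟩ := hc₁.exists_integral_abs_le
  obtain ⟨C₂, hC₂0, hC₂⟩ := hc₂.exists_integral_abs_le
  have hb := norm_iteratedFDeriv_zero_le hK
  have hK0 : 0 ≤ K := (abs_nonneg _).trans (hb 0)
  have hY1 := hc₁.continuousOn_integral hψ.continuous hb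
  have hY2 := hc₂.continuousOn_integral hψ.continuous hb
  have hG1 := hc₁.continuousOn_weakRHS D δ hω hψ hK
  have hG2 := hc₂.continuousOn_weakRHS D δ hω hψ hK
  have bY1 : ∀ t ∈ Ico 0 T, |∫ x, ρ₁ t x * ψ x| ≤ C₁ * K := fun t ht =>
    abs_integral_mul_le (hc₁.integrable ht) hb (hC₁ t ht)
  have bY2 : ∀ t ∈ Ico 0 T, |∫ x, ρ₂ t x * ψ x| ≤ C₂ * K := fun t ht =>
    abs_integral_mul_le (hc₂.integrable ht) hb (hC₂ t ht)
  have bG1 := fun t ht => abs_weakRHS_le D δ hω (hc₁.integrable (t := t) ht) (hC₁ t ht) hψ hK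
  have bG2 := fun t ht => abs_weakRHS_le D δ hω (hc₂.integrable (t := t) ht) (hC₂ t ht) hψ hK
  set A := max (C₁ * K + C₂ * K) ((|D| * (C₁ * (d * K)) + C₁ * C₁ * K * driftConst δ ω) +
    (|D| * (C₂ * (d * K)) + C₂ * C₂ * K * driftConst δ ω)) with hA
  refine eq_integral_of_weak (C := A) hT (hY1.sub hY2) (hG1.sub hG2)
    (fun t ht => ((abs_sub _ _).trans (add_le_add (bY1 t ht) (bY2 t ht))).trans (le_max_left _ _))
    (fun t ht => ((abs_sub _ _).trans (add_le_add (bG1 t ht) (bG2 t ht))).trans (le_max_right _ _))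
    fun θ h1 h2 h3 => ?_
  have w1 := hs₁.weak_in_time hω hc₁ hψ hψc hK h1 h2 h3
  have w2 := hs₂.weak_in_time hω hc₂ hψ hψc hK h1 h2 h3
  obtain ⟨B, hB⟩ := h1.continuous.bounded_above_of_compact_support h2
  have hθ' : Continuous (deriv θ) := h1.continuous_deriv (by simp)
  obtain ⟨B', hB'⟩ := hθ'.bounded_above_of_compact_support h2.deriv
  have iY1 := (integrableOn_Ioo_of_continuousOn hY1 bY1).bdd_mul
    hθ'.aestronglyMeasurable (Eventually.of_forall hB')
  have iY2 := (integrableOn_Ioo_of_continuousOn hY2 bY2).bdd_mul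
    hθ'.aestronglyMeasurable (Eventually.of_forall hB')
  have iG1 := (integrableOn_Ioo_of_continuousOn hG1 bG1).bdd_mul
    h1.continuous.aestronglyMeasurable (Eventually.of_forall hB)
  have iG2 := (integrableOn_Ioo_of_continuousOn hG2 bG2).bdd_mul
    h1.continuous.aestronglyMeasurable (Eventually.of_forall hB)
  -- Subtracting the two weak formulations cancels the common initial term, leaving no contribution
  -- of `θ 0`.
  simp only [mul_sub]
  rw [integral_sub iY1 iY2, integral_sub iG1 iG2]
  linarith

lemma tendsto_integral_of_eventually_eq {u : Space d → ℝ} (hu : Integrable u)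
    {f : ℕ → Space d → ℝ} {g : Space d → ℝ} (hf : ∀ n, Continuous (f n)) {L : ℝ}
    (hL : ∀ n x, |f n x| ≤ L) (h : ∀ x, ∀ᶠ n in atTop, f n x = g x) :
    Tendsto (fun n => ∫ x, u x * f n x) atTop (𝓝 (∫ x, u x * g x)) := by
  refine tendsto_integral_of_dominated_convergence (fun x => |u x| * L)
    (fun n => hu.1.mul (hf n).aestronglyMeasurable) (hu.abs.mul_const L)
    (fun n => Eventually.of_forall fun x => ?_) (Eventually.of_forall fun x => ?_)
  · rw [norm_mul, Real.norm_eq_abs]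
    gcongr
    exact hL n x
  · refine tendsto_const_nhds.congr' ?_
    filter_upwards [h x] with n hn
    rw [hn]

/-- Dominated convergence: the cut-off test functions have uniformly bounded derivatives up to order
two, which are pointwise eventually equal to those of `ψ`, and the gradient of the potential is
bounded while `u` is integrable. -/
lemma tendsto_weakRHS_cutoff (D δ : ℝ) (hω : IsShortRangeKernel ω) {u ψ : Space d → ℝ}
    (hu : Integrable u) (hψ : ContDiff ℝ (⊤ : ℕ∞) ψ)
    {K : ℝ} (hK : ∀ n : ℕ, ∀ i ≤ 2, ∀ x : Space d,
      ‖iteratedFDeriv ℝ i (fun y => cutoff d n y * ψ y) x‖ ≤ K) :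
    Tendsto (fun n => weakRHS D δ ω u (fun y => cutoff d n y * ψ y)) atTop
      (𝓝 (weakRHS D δ ω u ψ)) := by
  have hloc : ∀ x, ∀ᶠ n in atTop, (fun y => cutoff d n y * ψ y) =ᶠ[𝓝 x] ψ := fun x => by
    filter_upwards [cutoff_eventually_eq_one x] with n hn
    filter_upwards [hn] with y hy
    rw [hy, one_mul]
  have hcd : ∀ n, ContDiff ℝ (⊤ : ℕ∞) (fun y => cutoff d n y * ψ y) := fun n =>
    (contDiff_cutoff d n).mul hψ
  refine (Tendsto.const_mul D (tendsto_integral_of_eventually_eq hu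
    (fun n => continuous_laplacian (hcd n)) (fun n x => abs_laplacian_le (hK n 2 le_rfl x))
    fun x => ?_)).sub ?_
  · filter_upwards [hloc x] with n hn
    exact (InnerProductSpace.laplacian_congr_nhds hn).eq_of_nhds
  · have hrew : ∀ b : Space d → Space d, Continuous b → ∀ L : ℝ, (∀ x, ‖b x‖ ≤ L) →
        Integrable (fun x => u x * inner ℝ (gradient (potential δ ω u) x) (b x)) :=
      fun b hb L hL => by
        have := (integrable_drift_prod δ hω hu hb hL).integral_prod_left.re
        refine this.congr (Eventually.of_forall fun x => ?_)
        simp only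
        rw [integral_const_mul, inner_gradient_potential δ hω hu]
        simp only [RCLike.re_to_complex, Complex.re_ofReal_mul]
        rfl
    refine tendsto_integral_of_dominated_convergence
      (fun x => |u x| * (driftConst δ ω * (∫ x, |u x|) * K))
      (fun n => (hrew _ (continuous_gradient (hcd n)) K
        fun x => norm_gradient_le (hK n 1 (by norm_num) x)).1) (hu.abs.mul_const _)
      (fun n => Eventually.of_forall fun x => ?_) (Eventually.of_forall fun x => ?_)
    · rw [norm_mul, Real.norm_eq_abs]
      gcongr
      exact abs_inner_gradient_potential_le δ hω hu le_rfl
        (norm_gradient_le (hK n 1 (by norm_num) x)) x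
    · refine tendsto_const_nhds.congr' ?_
      filter_upwards [hloc x] with n hn
      rw [hn.gradient_eq]

/-- The integrated equation for the difference of two solutions, bounded smooth test function. -/
lemma integral_sub_eq (hT : 0 < T) (hω : IsShortRangeKernel ω)
    (hc₁ : InUniquenessClass T ρ₁) (hc₂ : InUniquenessClass T ρ₂)
    (hs₁ : IsDistributionalSolution T D δ ω ρ0 ρ₁) (hs₂ : IsDistributionalSolution T D δ ω ρ0 ρ₂)
    {ψ : Space d → ℝ} (hψ : ContDiff ℝ (⊤ : ℕ∞) ψ)
    {K : ℝ} (hK : ∀ i ≤ 2, ∀ x, ‖iteratedFDeriv ℝ i ψ x‖ ≤ K) :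
    ∀ t ∈ Ico 0 T, (∫ x, ρ₁ t x * ψ x) - (∫ x, ρ₂ t x * ψ x) =
      ∫ s in (0 : ℝ)..t, (weakRHS D δ ω (ρ₁ s) ψ - weakRHS D δ ω (ρ₂ s) ψ) := by
  intro t ht
  obtain ⟨C₁, -, hC₁⟩ := hc₁.exists_integral_abs_le
  obtain ⟨C₂, -, hC₂⟩ := hc₂.exists_integral_abs_le
  obtain ⟨K', -, hK'⟩ := exists_norm_iteratedFDeriv_cutoff_mul_le hψ hK
  have hcd : ∀ n, ContDiff ℝ (⊤ : ℕ∞) (fun y => cutoff d n y * ψ y) := fun n =>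
    (contDiff_cutoff d n).mul hψ
  have hsub : Ioc 0 t ⊆ Ico 0 T := fun s hs => ⟨hs.1.le, hs.2.trans_lt ht.2⟩
  have heq := fun n => integral_sub_eq_of_hasCompactSupport hT hω hc₁ hc₂ hs₁ hs₂ (hcd n)
    (hasCompactSupport_cutoff d n).mul_right (hK' n) t ht
  have hev : ∀ x, ∀ᶠ n in atTop, cutoff d n x * ψ x = ψ x := fun x => by
    filter_upwards [cutoff_eventually_eq_one x] with n hn
    rw [hn.self_of_nhds, one_mul]
  have hl := (tendsto_integral_of_eventually_eq (hc₁.integrable ht) (fun n => (hcd n).continuous)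
    (fun n => norm_iteratedFDeriv_zero_le (hK' n)) hev).sub
    (tendsto_integral_of_eventually_eq (hc₂.integrable ht) (fun n => (hcd n).continuous)
    (fun n => norm_iteratedFDeriv_zero_le (hK' n)) hev)
  refine tendsto_nhds_unique hl ?_
  simp only [heq]
  refine intervalIntegral.tendsto_integral_filter_of_dominated_convergence
    (fun _ => (|D| * (C₁ * (d * K')) + C₁ * C₁ * K' * driftConst δ ω) +
      (|D| * (C₂ * (d * K')) + C₂ * C₂ * K' * driftConst δ ω))
    (Eventually.of_forall fun n => ?_) (Eventually.of_forall fun n => ?_)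
    intervalIntegrable_const (Eventually.of_forall fun s hs => ?_)
  · rw [uIoc_of_le ht.1]
    exact (((hc₁.continuousOn_weakRHS D δ hω (hcd n) (hK' n)).sub
      (hc₂.continuousOn_weakRHS D δ hω (hcd n) (hK' n))).mono hsub).aestronglyMeasurable
      measurableSet_Ioc
  · refine Eventually.of_forall fun s hs => ?_
    rw [uIoc_of_le ht.1] at hs
    exact (abs_sub _ _).trans (add_le_add
      (abs_weakRHS_le D δ hω (hc₁.integrable (hsub hs)) (hC₁ s (hsub hs)) (hcd n) (hK' n))
      (abs_weakRHS_le D δ hω (hc₂.integrable (hsub hs)) (hC₂ s (hsub hs)) (hcd n) (hK' n)))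
  · rw [uIoc_of_le ht.1] at hs
    exact (tendsto_weakRHS_cutoff D δ hω (hc₁.integrable (hsub hs)) hψ hK').sub
      (tendsto_weakRHS_cutoff D δ hω (hc₂.integrable (hsub hs)) hψ hK')

end WeakForm

/-! ### Plane waves as test functions and the damped equation. -/

lemma hasFDerivAt_planeWave (ξ : Space d) (θ : ℝ) (x : Space d) :
    HasFDerivAt (planeWave ξ θ)
      (planeWave ξ (θ + Real.pi / 2) x • innerSL ℝ ((2 * Real.pi) • ξ)) x := by
  have h1 : HasFDerivAt (fun x : Space d => 2 * Real.pi * inner ℝ x ξ + θ)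
      (innerSL ℝ ((2 * Real.pi) • ξ)) x := by
    have h := ((innerSL ℝ ((2 * Real.pi) • ξ)).hasFDerivAt (x := x)).add_const θ
    refine h.congr_of_eventuallyEq (Eventually.of_forall fun y => ?_)
    simp [real_inner_comm]
  have h2 := h1.cos
  have h3 : planeWave ξ (θ + Real.pi / 2) x = -Real.sin (2 * Real.pi * inner ℝ x ξ + θ) := by
    rw [planeWave, ← add_assoc, Real.cos_add_pi_div_two]
  rw [h3]
  exact h2

lemma contDiff_planeWave (ξ : Space d) (θ : ℝ) : ContDiff ℝ (⊤ : ℕ∞) (planeWave ξ θ) :=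
  Real.contDiff_cos.comp
    ((contDiff_const.mul (contDiff_id.inner ℝ contDiff_const)).add contDiff_const)

lemma gradient_planeWave (ξ : Space d) (θ : ℝ) : gradient (planeWave ξ θ) =
    fun x => planeWave ξ (θ + Real.pi / 2) x • ((2 * Real.pi) • ξ) := by
  refine gradient_eq fun x => ?_
  rw [hasGradientAt_iff_hasFDerivAt]
  refine (hasFDerivAt_planeWave ξ θ x).congr_fderiv ?_
  ext y
  simp

lemma laplacian_planeWave (ξ : Space d) (θ : ℝ) (x : Space d) :
    Laplacian.laplacian (planeWave ξ θ) x = -(4 * Real.pi ^ 2 * ‖ξ‖ ^ 2) * planeWave ξ θ x := by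
  rw [laplacian_eq_sum_fderiv (contDiff_infty.1 (contDiff_planeWave ξ θ) 2)]
  have h1 : ∀ θ (i : Fin d) y, fderiv ℝ (planeWave ξ θ) y (EuclideanSpace.single i 1) =
      (2 * Real.pi * ξ i) * planeWave ξ (θ + Real.pi / 2) y := fun θ i y => by
    rw [(hasFDerivAt_planeWave ξ θ y).fderiv, _root_.smul_apply, innerSL_apply_apply,
      EuclideanSpace.inner_single_right]
    simp
    ring
  have h2 : ∀ i : Fin d, fderiv ℝ (fun y => fderiv ℝ (planeWave ξ θ) y (EuclideanSpace.single i 1))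
      x (EuclideanSpace.single i 1) = -(4 * Real.pi ^ 2 * planeWave ξ θ x) * ξ i ^ 2 := fun i => by
    rw [funext fun y => h1 θ i y,
      fderiv_const_mul (hasFDerivAt_planeWave ξ _ x).differentiableAt,
      _root_.smul_apply, h1]
    have : planeWave ξ (θ + Real.pi / 2 + Real.pi / 2) x = -planeWave ξ θ x := by
      rw [planeWave, planeWave, add_assoc θ, add_halves, ← add_assoc, Real.cos_add_pi]
    rw [this, smul_eq_mul]
    ring
  simp only [h2]
  rw [← Finset.mul_sum, ← EuclideanSpace.real_norm_sq_eq]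
  ring

lemma exists_norm_iteratedFDeriv_planeWave_le (ξ : Space d) (θ : ℝ) : ∃ K : ℝ, ∀ i ≤ 2,
    ∀ x, ‖iteratedFDeriv ℝ i (planeWave ξ θ) x‖ ≤ K := by
  set L : Space d →L[ℝ] ℝ := innerSL ℝ ((2 * Real.pi) • ξ) with hL
  set g : ℝ → ℝ := fun s => Real.cos (s + θ) with hg
  have hgs : ContDiff ℝ (⊤ : ℕ∞) g := Real.contDiff_cos.comp (contDiff_id.add contDiff_const)
  have hcomp : planeWave ξ θ = g ∘ L := by
    ext x
    simp [planeWave, hg, hL, real_inner_comm]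
  -- The wave is a shifted cosine composed with the linear form `L`, so its `i`-th derivative is at
  -- most `‖L‖ ^ i`; adding one to the base lets the second power dominate all orders `i ≤ 2`.
  refine ⟨(1 + ‖L‖) ^ 2, fun i hi x => ?_⟩
  rw [hcomp, L.iteratedFDeriv_comp_right hgs x (by exact_mod_cast le_top)]
  refine (ContinuousMultilinearMap.norm_compContinuousLinearMap_le _ _).trans ?_
  have h1 : ‖iteratedFDeriv ℝ i g (L x)‖ ≤ 1 := by
    rw [norm_iteratedFDeriv_eq_norm_iteratedDeriv, hg, iteratedDeriv_comp_add_const]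
    exact Real.abs_iteratedDeriv_cos_le_one i _
  calc _ ≤ 1 * ‖L‖ ^ i := by
        simp only [Finset.prod_const, Finset.card_univ, Fintype.card_fin]
        gcongr
    _ ≤ (1 + ‖L‖) ^ i := by
        rw [one_mul]
        gcongr
        linarith
    _ ≤ (1 + ‖L‖) ^ 2 := pow_le_pow_right₀ (by linarith [norm_nonneg L]) hi

lemma integral_mul_planeWave {u : Space d → ℝ} (hu : Integrable u) (ξ : Space d) (θ : ℝ) :
    ∫ x, u x * planeWave ξ θ x = (Complex.exp (-θ * Complex.I) * realFourier u ξ).re := by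
  have hi : Integrable (fun x => Complex.exp (-θ * Complex.I) *
      ((u x : ℂ) * (Real.fourierChar (-inner ℝ x ξ) : ℂ))) :=
    (hu.ofReal.mul_bdd (c := 1) (Continuous.aestronglyMeasurable (by fun_prop))
      (Eventually.of_forall fun x => (Circle.norm_coe _).le)).const_mul _
  rw [realFourier_eq_integral, ← integral_const_mul]
  refine Eq.trans ?_ (integral_re hi)
  congr with x
  rw [mul_left_comm, Real.fourierChar_apply, ← Complex.exp_add]
  simp only [RCLike.re_to_complex, Complex.re_ofReal_mul]
  have : -(θ : ℂ) * Complex.I + ((2 * Real.pi * -inner ℝ x ξ : ℝ) : ℂ) * Complex.I =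
      ((-(2 * Real.pi * inner ℝ x ξ + θ) : ℝ) : ℂ) * Complex.I := by push_cast; ring
  rw [this, Complex.exp_ofReal_mul_I_re, Real.cos_neg, planeWave]

/-- Weighted bound for a damped linear equation in integrated form. -/
lemma abs_le_of_damped_integral_eq {T c A μ : ℝ} (hc : 0 ≤ c) (hμ : 0 < μ) {W f : ℝ → ℝ}
    (hW : ContinuousOn W (Ico 0 T)) (hf : ContinuousOn f (Ico 0 T))
    (h : ∀ t ∈ Ico 0 T, W t = ∫ s in (0 : ℝ)..t, (-c * W s + f s))
    (hA : ∀ t ∈ Ico 0 T, |f t| ≤ A * Real.exp (μ * t)) :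
    ∀ t ∈ Ico 0 T, |W t| ≤ A / (c + μ) * Real.exp (μ * t) := by
  intro t ht
  have hsub : Icc 0 t ⊆ Ico 0 T := fun s hs => ⟨hs.1, hs.2.trans_lt ht.2⟩
  have hg : ContinuousOn (fun s => -c * W s + f s) (Ico 0 T) := (continuousOn_const.mul hW).add hf
  have hW0 : W 0 = 0 := by rw [h 0 ⟨le_rfl, ht.1.trans_lt ht.2⟩]; simp
  have hA0 : 0 ≤ A := by
    have := (abs_nonneg _).trans (hA 0 ⟨le_rfl, ht.1.trans_lt ht.2⟩)
    simpa using this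
  have hd : ∀ s ∈ Ioo 0 t, HasDerivAt W (-c * W s + f s) s := fun s hs => by
    have hsT : s ∈ Ioo 0 T := ⟨hs.1, hs.2.trans ht.2⟩
    have h1 : HasDerivAt (fun r => ∫ q in (0 : ℝ)..r, (-c * W q + f q)) (-c * W s + f s) s := by
      refine intervalIntegral.integral_hasDerivAt_right ?_ ?_
        ((hg s (Ioo_subset_Ico_self hsT)).continuousAt (Ico_mem_nhds hsT.1 hsT.2))
      · refine ContinuousOn.intervalIntegrable (hg.mono ?_)
        rw [uIcc_of_le hs.1.le]
        exact (Icc_subset_Icc_right hs.2.le).trans hsub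
      · exact (hg.mono Ioo_subset_Ico_self).stronglyMeasurableAtFilter isOpen_Ioo s hsT
    refine h1.congr_of_eventuallyEq ?_
    filter_upwards [Ico_mem_nhds hsT.1 hsT.2] with r hr using h r hr
  have hexp : ∀ a s : ℝ, HasDerivAt (fun r => Real.exp (a * r)) (Real.exp (a * s) * a) s :=
    fun a s => by simpa using ((hasDerivAt_id s).const_mul a).exp
  have hi : IntervalIntegrable (fun s => Real.exp (c * s) * f s) volume 0 t := by
    refine ContinuousOn.intervalIntegrable ?_
    rw [uIcc_of_le ht.1]
    exact (Continuous.continuousOn (by fun_prop)).mul (hf.mono hsub)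
  -- Duhamel's formula with integrating factor `exp (c * s)`. Against a forcing of size `A * exp (μ
  -- * s)` it integrates `exp ((c + μ) * s)`, which produces the gain `1 / (c + μ)`.
  have hduh := intervalIntegral.integral_eq_sub_of_hasDerivAt_of_le ht.1
    (f := fun s => Real.exp (c * s) * W s) (f' := fun s => Real.exp (c * s) * f s)
    ((Continuous.continuousOn (by fun_prop)).mul (hW.mono hsub))
    (fun s hs => ((hexp c s).mul (hd s hs)).congr_deriv (by ring)) hi
  simp only [hW0, mul_zero, sub_zero] at hduh
  have hcμ : 0 < c + μ := by linarith
  have hint : ∫ s in (0 : ℝ)..t, A * Real.exp ((c + μ) * s) =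
      A / (c + μ) * Real.exp ((c + μ) * t) - A / (c + μ) := by
    rw [intervalIntegral.integral_eq_sub_of_hasDerivAt
      (f := fun s => A / (c + μ) * Real.exp ((c + μ) * s))
      (fun s _ => ((hexp (c + μ) s).const_mul (A / (c + μ))).congr_deriv (by field_simp))
      (Continuous.intervalIntegrable (by fun_prop) _ _)]
    simp
  have hbi : IntervalIntegrable (fun s => A * Real.exp ((c + μ) * s)) volume 0 t :=
    Continuous.intervalIntegrable (by fun_prop) _ _
  have hle : |Real.exp (c * t) * W t| ≤ A / (c + μ) * Real.exp ((c + μ) * t) := by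
    rw [← hduh, ← Real.norm_eq_abs]
    refine (intervalIntegral.norm_integral_le_of_norm_le ht.1
      (g := fun s => A * Real.exp ((c + μ) * s)) (Eventually.of_forall fun s hs => ?_) hbi).trans ?_
    · rw [norm_mul, Real.norm_eq_abs, Real.norm_eq_abs, abs_of_pos (Real.exp_pos _), add_mul,
        Real.exp_add, mul_left_comm]
      gcongr
      exact hA s (hsub ⟨hs.1.le, hs.2⟩)
    · rw [hint]
      have : 0 ≤ A / (c + μ) := by positivity
      linarith
  rw [abs_mul, abs_of_pos (Real.exp_pos _), add_mul, Real.exp_add, mul_left_comm] at hle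
  exact le_of_mul_le_mul_left hle (Real.exp_pos _)

lemma weakRHS_planeWave (D δ : ℝ) (ω u : Space d → ℝ) (ξ : Space d) (θ : ℝ) :
    weakRHS D δ ω u (planeWave ξ θ) =
      -(4 * Real.pi ^ 2 * D * ‖ξ‖ ^ 2) * (∫ x, u x * planeWave ξ θ x) -
        driftPairing δ ω u (fun x => planeWave ξ (θ + Real.pi / 2) x • ((2 * Real.pi) • ξ)) := by
  rw [weakRHS, gradient_planeWave, ← integral_const_mul, ← integral_const_mul]
  congr 2 with x
  rw [laplacian_planeWave]
  ring

/-! ### Contraction and conclusion. -/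

section Uniqueness

variable {T D δ : ℝ} {ω ρ0 : Space d → ℝ} {ρ₁ ρ₂ : ℝ → Space d → ℝ}

lemma realFourier_sub {u v : Space d → ℝ} (hu : Integrable u) (hv : Integrable v) (ξ : Space d) :
    realFourier (fun x => u x - v x) ξ = realFourier u ξ - realFourier v ξ := by
  have hi : ∀ {w : Space d → ℝ}, Integrable w →
      Integrable (fun x => (w x : ℂ) * (Real.fourierChar (-inner ℝ x ξ) : ℂ)) := fun hw =>
    hw.ofReal.mul_bdd (c := 1) (Continuous.aestronglyMeasurable (by fun_prop))
      (Eventually.of_forall fun x => (Circle.norm_coe _).le)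
  simp only [realFourier_eq_integral]
  rw [← integral_sub (hi hu) (hi hv)]
  congr with x
  push_cast
  ring

/-- In the exponentially weighted supremum norm of the Fourier transform, the difference of two
solutions is at most half its own size. -/
lemma norm_realFourier_sub_le_half (hT : 0 < T) (hD : 0 < D) (hω : IsShortRangeKernel ω)
    (hc₁ : InUniquenessClass T ρ₁) (hc₂ : InUniquenessClass T ρ₂)
    (hs₁ : IsDistributionalSolution T D δ ω ρ0 ρ₁) (hs₂ : IsDistributionalSolution T D δ ω ρ0 ρ₂)
    {C : ℝ} (hC₁ : ∀ t ∈ Ico 0 T, ∫ x, |ρ₁ t x| ≤ C) (hC₂ : ∀ t ∈ Ico 0 T, ∫ x, |ρ₂ t x| ≤ C)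
    {μ : ℝ} (hμ : μ = 4 * (C * driftConst δ ω) ^ 2 / D + 1) {B : ℝ}
    (hB : ∀ t ∈ Ico 0 T, ∀ ξ, ‖realFourier (ρ₁ t) ξ - realFourier (ρ₂ t) ξ‖ ≤ B * Real.exp (μ * t)) :
    ∀ t ∈ Ico 0 T, ∀ ξ, ‖realFourier (ρ₁ t) ξ - realFourier (ρ₂ t) ξ‖ ≤
      B / 2 * Real.exp (μ * t) := by
  intro t ht ξ
  have hB0 : 0 ≤ B := by simpa using (norm_nonneg _).trans (hB 0 ⟨le_rfl, hT⟩ ξ)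
  set κ := driftConst δ ω with hκ
  set z := realFourier (ρ₁ t) ξ - realFourier (ρ₂ t) ξ with hz
  -- The phase is adapted to the fixed pair `(t, ξ)`: `W s` is the real part of `exp (-θ i)` times
  -- the difference of transforms at time `s`, so at `s = t` it is exactly `‖z‖`. A real test
  -- function thus recovers the full complex modulus.
  set θ : ℝ := z.arg with hθ
  set c : ℝ := 4 * Real.pi ^ 2 * D * ‖ξ‖ ^ 2 with hc
  set b : Space d → Space d := fun x => planeWave ξ (θ + Real.pi / 2) x • ((2 * Real.pi) • ξ) with hb
  have hbc : Continuous b := (continuous_planeWave _ _).smul continuous_const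
  have hbb : ∀ x, ‖b x‖ ≤ ‖(2 * Real.pi) • ξ‖ := fun x => by
    rw [hb]
    simp only
    rw [norm_smul (planeWave _ _ _), Real.norm_eq_abs]
    exact mul_le_of_le_one_left (norm_nonneg _) (abs_planeWave_le_one _ _ x)
  obtain ⟨K, hK⟩ := exists_norm_iteratedFDeriv_planeWave_le ξ θ
  set W : ℝ → ℝ := fun s => (∫ x, ρ₁ s x * planeWave ξ θ x) - ∫ x, ρ₂ s x * planeWave ξ θ x with hW
  set f : ℝ → ℝ := fun s => -(driftPairing δ ω (ρ₁ s) b - driftPairing δ ω (ρ₂ s) b) with hf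
  have hWc : ContinuousOn W (Ico 0 T) :=
    (hc₁.continuousOn_integral (continuous_planeWave ξ θ) (abs_planeWave_le_one ξ θ)).sub
      (hc₂.continuousOn_integral (continuous_planeWave ξ θ) (abs_planeWave_le_one ξ θ))
  have hfc : ContinuousOn f (Ico 0 T) := ((hc₁.continuousOn_driftPairing δ hω hbc hbb).sub
    (hc₂.continuousOn_driftPairing δ hω hbc hbb)).neg
  have heq : ∀ t ∈ Ico 0 T, W t = ∫ s in (0 : ℝ)..t, (-c * W s + f s) := fun t ht => by
    rw [hW]
    simp only
    rw [integral_sub_eq hT hω hc₁ hc₂ hs₁ hs₂ (contDiff_planeWave ξ θ) hK t ht]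
    congr with s
    rw [weakRHS_planeWave, weakRHS_planeWave]
    simp only [hf, hc, hb]
    ring
  have hμ0 : 0 < μ := by rw [hμ]; positivity
  have hc0 : 0 ≤ c := by positivity
  -- The factor `2 * π * ‖ξ‖` in `A` is the norm of the wave vector produced by the gradient of the
  -- plane wave; the rest is the Lipschitz constant times `B`.
  have key := abs_le_of_damped_integral_eq (A := 2 * C * κ * (2 * Real.pi * ‖ξ‖) * B) hc0 hμ0
    hWc hfc heq (fun s hs => by
      rw [hf]
      simp only
      rw [abs_neg]
      refine (abs_driftPairing_sub_le δ hω (hc₁.integrable hs) (hc₂.integrable hs) (hC₁ s hs)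
        (hC₂ s hs) (hB s hs) ξ ((2 * Real.pi) • ξ) (θ + Real.pi / 2)).trans_eq ?_
      rw [norm_smul, Real.norm_of_nonneg (by positivity)]
      ring) t ht
  have hWt : W t = ‖z‖ := by
    simp only [hW]
    rw [integral_mul_planeWave (hc₁.integrable ht), integral_mul_planeWave (hc₂.integrable ht),
      ← Complex.sub_re, ← mul_sub, ← hz]
    have h1 : Complex.exp (-θ * Complex.I) * z = (‖z‖ : ℂ) := by
      conv_lhs => rw [← Complex.norm_mul_exp_arg_mul_I z]
      rw [mul_left_comm, ← Complex.exp_add]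
      simp [hθ]
    rw [h1, Complex.ofReal_re]
  rw [hWt, abs_of_nonneg (norm_nonneg _)] at key
  refine key.trans (mul_le_mul_of_nonneg_right ?_ (Real.exp_pos _).le)
  have hcμ : 0 < c + μ := by linarith
  rw [div_le_div_iff₀ hcμ two_pos]
  -- Completing the square explains the choice of `μ`: the term `4 * (C * κ) ^ 2 / D` is what the
  -- quadratic damping needs to dominate the linear growth in `‖ξ‖` with a factor two to spare, and
  -- the extra `1` keeps `μ` positive.
  have h1 : c + μ - 8 * Real.pi * (C * κ) * ‖ξ‖ =
      (2 * Real.pi * D * ‖ξ‖ - 2 * (C * κ)) ^ 2 / D + 1 := by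
    rw [hc, hμ]
    field_simp
    ring
  have h2 : 8 * Real.pi * (C * κ) * ‖ξ‖ ≤ c + μ := by
    have : 0 ≤ (2 * Real.pi * D * ‖ξ‖ - 2 * (C * κ)) ^ 2 / D := by positivity
    linarith
  calc 2 * C * κ * (2 * Real.pi * ‖ξ‖) * B * 2 = B * (8 * Real.pi * (C * κ) * ‖ξ‖) := by ring
    _ ≤ B * (c + μ) := by gcongr

lemma ae_eq_of_isDistributionalSolution (hT : 0 < T) (hD : 0 < D) (hω : IsShortRangeKernel ω)
    (hc₁ : InUniquenessClass T ρ₁) (hc₂ : InUniquenessClass T ρ₂)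
    (hs₁ : IsDistributionalSolution T D δ ω ρ0 ρ₁) (hs₂ : IsDistributionalSolution T D δ ω ρ0 ρ₂) :
    ∀ t ∈ Ico 0 T, ρ₁ t =ᵐ[volume] ρ₂ t := by
  obtain ⟨C₁, -, hC₁⟩ := hc₁.exists_integral_abs_le
  obtain ⟨C₂, -, hC₂⟩ := hc₂.exists_integral_abs_le
  set C := max C₁ C₂ with hC
  have hC₁' : ∀ t ∈ Ico 0 T, ∫ x, |ρ₁ t x| ≤ C := fun t ht => (hC₁ t ht).trans (le_max_left _ _)
  have hC₂' : ∀ t ∈ Ico 0 T, ∫ x, |ρ₂ t x| ≤ C := fun t ht => (hC₂ t ht).trans (le_max_right _ _)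
  set μ := 4 * (C * driftConst δ ω) ^ 2 / D + 1 with hμ
  have hμ0 : 0 < μ := by positivity
  -- The iteration starts from the trivial bound of each transform by its `L¹` norm; since `μ` does
  -- not depend on the current bound, the halving can be repeated indefinitely.
  have hiter : ∀ n : ℕ, ∀ t ∈ Ico 0 T, ∀ ξ, ‖realFourier (ρ₁ t) ξ - realFourier (ρ₂ t) ξ‖ ≤
      2 * C * (1 / 2) ^ n * Real.exp (μ * t) := by
    intro n
    induction n with
    | zero =>
      intro t ht ξ
      have h1 := (norm_realFourier_le (ρ₁ t) ξ).trans (hC₁' t ht)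
      have h2 := (norm_realFourier_le (ρ₂ t) ξ).trans (hC₂' t ht)
      have h3 : 1 ≤ Real.exp (μ * t) := Real.one_le_exp (mul_nonneg hμ0.le ht.1)
      have h4 : 0 ≤ C := (norm_nonneg _).trans h1
      refine (norm_sub_le _ _).trans ?_
      rw [pow_zero, mul_one]
      nlinarith
    | succ n ih =>
      intro t ht ξ
      have := norm_realFourier_sub_le_half hT hD hω hc₁ hc₂ hs₁ hs₂ hC₁' hC₂' hμ ih t ht ξ
      refine this.trans_eq ?_
      rw [pow_succ]
      ring
  intro t ht
  have hzero : ∀ ξ, realFourier (fun x => ρ₁ t x - ρ₂ t x) ξ = 0 := fun ξ => by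
    rw [realFourier_sub (hc₁.integrable ht) (hc₂.integrable ht)]
    have hlim : Tendsto (fun n : ℕ => 2 * C * (1 / 2 : ℝ) ^ n * Real.exp (μ * t)) atTop (𝓝 0) := by
      have := ((tendsto_pow_atTop_nhds_zero_of_lt_one (r := (1 / 2 : ℝ)) (by norm_num)
        (by norm_num)).const_mul (2 * C)).mul_const (Real.exp (μ * t))
      simpa using this
    exact norm_le_zero_iff.1 (ge_of_tendsto' hlim fun n => hiter n t ht ξ)
  filter_upwards [ae_eq_zero_of_realFourier_eq_zero
    ((hc₁.integrable ht).sub (hc₂.integrable ht)) hzero] with x hx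
  exact sub_eq_zero.1 hx

end Uniqueness

end NonlocalCahnHilliard

end

theorem mainTheorem5 (d : ℕ) (hd : 3 ≤ d) (T D δ : ℝ) (hT : 0 < T) (hD : 0 < D) (hδ : 0 < δ)
    (ω : NonlocalCahnHilliard.Space d → ℝ) (hω : NonlocalCahnHilliard.IsShortRangeKernel ω)
    (ρ0 : NonlocalCahnHilliard.Space d → ℝ) (hρ0 : Integrable ρ0)
    (ρ₁ ρ₂ : ℝ → NonlocalCahnHilliard.Space d → ℝ)
    (hc₁ : NonlocalCahnHilliard.InUniquenessClass T ρ₁)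
    (hc₂ : NonlocalCahnHilliard.InUniquenessClass T ρ₂)
    (hs₁ : NonlocalCahnHilliard.IsDistributionalSolution T D δ ω ρ0 ρ₁)
    (hs₂ : NonlocalCahnHilliard.IsDistributionalSolution T D δ ω ρ0 ρ₂) :
    ∀ t ∈ Ico 0 T, ρ₁ t =ᵐ[volume] ρ₂ t :=
  NonlocalCahnHilliard.ae_eq_of_isDistributionalSolution hT hD hω hc₁ hc₂ hs₁ hs₂
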